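/- **Setting.** Let $\Delta\ge 3$ and $0\le c\le \Delta-2$ be integers and $\kappa=\Delta+c$. A *state* is a forest on a fixed set of $n$ vertices with maximum degree at most $\Delta$, together with a proper edge coloring with colors $1,\dots,\kappa$. An update inserts an edge (such that the graph remains a forest of maximum degree at most $\Delta$) or deletes an edge. The *recourse* of an update is the number of edges, present before and after the update, whose color is changed. A *greedy* algorithm keeps the coloring after a deletion, and after an insertion it moves to a proper $\kappa$-edge-coloring of the new forest with the minimum possible recourse. Ties are broken arbitrarily. A deterministic greedy algorithm is a greedy algorithm whose state is a function of the sequence of updates so far; it starts at the empty forest. For a real $B$, a state $S$ is *$B$-bad* if there is a cycle of $6$ updates that can be repeated forever starting at $S$ and such that for every $k\ge 0$, however ties are broken, after $k$ repetitions of the cycle greedy is back in the state $S$ and its total recourse is at least $6k\cdot B$ (so from $S$ onward its amortized recourse is at least $B$ per update). **Theorem.** There are absolute constants $C>0$ and $K\in\mathbb N$ such that for all integers $\Delta\ge3$ and $0\le c\le\Delta-2$ there is $n_1=n_1(\Delta,c)$ with the following property. For every $n\ge\Delta^K$ there is a state $S$ on $n$ vertices such that 1. $S$ is $(C\log_\Delta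 n)$-bad, that is, from $S$ onward the amortized recourse of every greedy algorithm on a repeated cycle of $6$ updates is $\Omega(\log_\Delta n)$; and 2. if $n\ge n_1$, then for every deterministic greedy algorithm there is a sequence of updates, starting at the empty forest, that leads the algorithm to a state which equals $S$ up to a renaming of the vertices and of the colors, and which is also $(C\log_\Delta n)$-bad. -/

import Mathlib

/-- A forest on the fixed vertex set `Fin n`, of maximum degree at most `Δ`, together with a proper
edge colouring by the palette `Fin κ`.  Pairs that are not edges carry no colour, so that two
coloured forests are equal exactly when they have the same edges and the same colours on them. -/
@[ext]
structure ColoredForest (n Δ κ : ℕ) where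
  graph : SimpleGraph (Fin n)
  color : Sym2 (Fin n) → Option (Fin κ)
  isAcyclic : graph.IsAcyclic
  degree_le : ∀ v, (graph.neighborSet v).ncard ≤ Δ
  isSome_color : ∀ e, (color e).isSome ↔ e ∈ graph.edgeSet
  proper : ∀ u v w, graph.Adj u v → graph.Adj u w → v ≠ w → color s(u, v) ≠ color s(u, w)

/-- The initial state: the forest without edges. -/
def ColoredForest.empty (n Δ κ : ℕ) : ColoredForest n Δ κ where
  graph := ⊥
  color := fun _ => none
  isAcyclic := SimpleGraph.isAcyclic_bot
  degree_le := by intro v; simp [SimpleGraph.neighborSet]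
  isSome_color := by intro e; simp
  proper := by intro u v w h; simp at h

/-- The number of edges that are present both before and after an update and whose colour
changes.  Giving a colour to the newly inserted edge does not count. -/
noncomputable def recourse {n Δ κ : ℕ} (S T : ColoredForest n Δ κ) : ℕ :=
  {e : Sym2 (Fin n) | e ∈ S.graph.edgeSet ∧ e ∈ T.graph.edgeSet ∧ S.color e ≠ T.color e}.ncard

/-- An update request of the adversary. -/
inductive Update (n : ℕ) where
  | insert (u v : Fin n)
  | delete (u v : Fin n)

/-- The effect of an update on the graph. -/
def Update.apply {n : ℕ} : Update n → SimpleGraph (Fin n) → SimpleGraph (Fin n)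
  | .insert u v, G => G ⊔ SimpleGraph.edge u v
  | .delete u v, G => G.deleteEdges {s(u, v)}

/-- An update is admissible if it inserts a new edge such that the graph remains a forest of
maximum degree at most `Δ`, or deletes an existing edge. -/
def Update.Admissible {n : ℕ} (Δ : ℕ) : Update n → SimpleGraph (Fin n) → Prop
  | .insert u v, G => u ≠ v ∧ ¬ G.Adj u v ∧ (G ⊔ SimpleGraph.edge u v).IsAcyclic ∧
      ∀ w, ((G ⊔ SimpleGraph.edge u v).neighborSet w).ncard ≤ Δ
  | .delete u v, G => G.Adj u v

/-- A sequence of updates (first update at the head of the list) each of which is admissible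
at the moment at which it is requested, when the sequence starts at the graph `G`. -/
def AdmissibleSeq {n : ℕ} (Δ : ℕ) : SimpleGraph (Fin n) → List (Update n) → Prop
  | _, [] => True
  | G, a :: as => a.Admissible Δ G ∧ AdmissibleSeq Δ (a.apply G) as

/-- `GreedyStep S a T`: on the admissible update `a`, a greedy algorithm in the state `S` may move
to the state `T`.  After an insertion it recolours as few edges as possible, where ties are broken
arbitrarily; after a deletion it keeps the colouring. -/
def GreedyStep {n Δ κ : ℕ} (S : ColoredForest n Δ κ) (a : Update n)
    (T : ColoredForest n Δ κ) : Prop :=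
  a.Admissible Δ S.graph ∧ T.graph = a.apply S.graph ∧
    match a with
    | .insert _ _ => ∀ T' : ColoredForest n Δ κ, T'.graph = T.graph → recourse S T ≤ recourse S T'
    | .delete _ _ => ∀ e ∈ T.graph.edgeSet, T.color e = S.color e

/-- `GreedyRun S as r T`: starting at `S` and serving the updates `as` greedily (with arbitrary
tie-breaking at each of them) one may end in `T` with total recourse `r`. -/
def GreedyRun {n Δ κ : ℕ} :
    ColoredForest n Δ κ → List (Update n) → ℕ → ColoredForest n Δ κ → Prop
  | S, [], r, T => r = 0 ∧ T = S
  | S, a :: as, r, T => ∃ (S' : ColoredForest n Δ κ) (r' : ℕ),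
      GreedyStep S a S' ∧ GreedyRun S' as r' T ∧ r = recourse S S' + r'

/-- A deterministic greedy algorithm that starts at the empty forest: it is given by the state that
it reaches after each history of updates (oldest update first), so its tie-breaking rule may depend
on the whole history.  Histories that are not admissible are irrelevant. -/
def IsGreedyAlgorithm {n Δ κ : ℕ} (A : List (Update n) → ColoredForest n Δ κ) : Prop :=
  A [] = ColoredForest.empty n Δ κ ∧
    ∀ (h : List (Update n)) (a : Update n),
      AdmissibleSeq Δ (⊥ : SimpleGraph (Fin n)) (h ++ [a]) → GreedyStep (A h) a (A (h ++ [a]))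

/-- From the state `S` onward, greedy has amortized recourse at least `B`: there is a cycle of six
updates that can be repeated for ever, and such that, for every number `k` of repetitions and however
ties are broken, greedy is back in the state `S` after the `k` repetitions and has paid on average
at least `B` per update. -/
def IsBadState {n Δ κ : ℕ} (S : ColoredForest n Δ κ) (B : ℝ) : Prop :=
  ∃ cycle : List (Update n), cycle.length = 6 ∧ ∀ k : ℕ,
    (∃ (r : ℕ) (T : ColoredForest n Δ κ), GreedyRun S (List.replicate k cycle).flatten r T) ∧
    ∀ (r : ℕ) (T : ColoredForest n Δ κ), GreedyRun S (List.replicate k cycle).flatten r T →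
      T = S ∧ B * (6 * k : ℝ) ≤ r

/-- Two coloured forests that coincide up to a renaming of the vertices and of the colours. -/
def SameUpToRenaming {n Δ κ : ℕ} (S T : ColoredForest n Δ κ) : Prop :=
  ∃ (σ : Equiv.Perm (Fin n)) (τ : Equiv.Perm (Fin κ)),
    ∀ e : Sym2 (Fin n), T.color (e.map σ) = (S.color e).map τ

/-! Give each inner vertex of a rooted tree a type: the set of the colours of its child edges, of
size `Δ - 1`. Let the child along the colour `r` have a type that avoids `r` and contains every
colour outside the parent's type. Such a tree is rigid. If the edge above a vertex of type `X`
receives a colour of `X`, then by pigeonhole some child edge is pushed to a colour outside `X`. That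
colour lies in the child's type, so the change runs down to the leaves (`Rigid.exists_walk`).

One cheap channel is left open: a path from the root through vertices of types `X₀, X₁, X₀, …`,
coloured `α, β, α, …`. Cut the tree at the edge between `x D` and its successor `v` on this path,
with `D` even. An edge between `x 0` and `v` then has no free colour. Disturbing the tree below `v`,
or leaving the path, recolours more than `D` edges, so the unique optimum is to exchange `α` and `β`
on the `D` path edges (`ZigZag.eq_of_greedyStep`). Once the inserted edge is deleted, the mirror
image of the situation has arisen: an edge between `x D` and `v` flips the path back
(`ZigZag.reverse`, `ZigZag.flip_flip`). With one harmless insertion and deletion added, six updates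
cost at least `2 * D`. The tree needs depth `2 * D + 2` only, so `D` can be of order `log_Δ n`.

To reach this tree the adversary must cope with colours chosen by the algorithm. The types are
designed so that whichever free colour a new child edge receives, the subtree attached is the right
one for that colour (`IsTypeSystem.exists_next`, `build_loop`). The recursion starts from stars with
prescribed colours. These come from many stars with one common, uncontrolled colour set `W`: by
deleting edges, and by joining vertices until the free colours are exhausted, every colour set of
size at most `Δ` can be made from `W` (`avail_of_card_le`). The construction is phrased for an
abstract game (`IsGame`), so that the same argument gives bare existence for moderate `n` and
forcing for large `n`. -/

namespace ColoredForest

/-! ### Colours at a vertex; insertions without recolouring, and deletions. -/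

variable {n Δ κ : ℕ} {S T : ColoredForest n Δ κ}

theorem adj_iff (S : ColoredForest n Δ κ) {a b : Fin n} :
    S.graph.Adj a b ↔ ∃ d, S.color s(a, b) = some d := by
  rw [← SimpleGraph.mem_edgeSet, ← S.isSome_color, Option.isSome_iff_exists]

theorem color_eq_none_iff (S : ColoredForest n Δ κ) {a b : Fin n} :
    S.color s(a, b) = none ↔ ¬ S.graph.Adj a b := by
  rw [adj_iff, Option.eq_none_iff_forall_ne_some]; push Not; rfl

theorem graph_eq_of_isSome (h : ∀ e, (S.color e).isSome ↔ (T.color e).isSome) :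
    S.graph = T.graph := by
  rw [← SimpleGraph.edgeSet_inj]
  ext e
  rw [← S.isSome_color, ← T.isSome_color, h]

theorem color_ext (h : S.color = T.color) : S = T :=
  ColoredForest.ext (graph_eq_of_isSome (by simp [h])) h

theorem eq_of_color_eq {u v w : Fin n} {d : Fin κ} (h₁ : S.color s(u, v) = some d)
    (h₂ : S.color s(u, w) = some d) : v = w := by
  by_contra h
  exact S.proper u v w (S.adj_iff.2 ⟨d, h₁⟩) (S.adj_iff.2 ⟨d, h₂⟩) h (h₁.trans h₂.symm)

theorem ne_of_color {u v : Fin n} {d : Fin κ} (h : S.color s(u, v) = some d) : u ≠ v :=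
  (S.adj_iff.2 ⟨d, h⟩).ne

open Classical in
/-- The colours of the edges at a vertex. -/
noncomputable def colorsAt (S : ColoredForest n Δ κ) (v : Fin n) : Finset (Fin κ) :=
  {d | ∃ w, S.color s(v, w) = some d}

theorem mem_colorsAt {v : Fin n} {d : Fin κ} :
    d ∈ S.colorsAt v ↔ ∃ w, S.color s(v, w) = some d := by
  simp [colorsAt]

/-- Properness makes the colour at `v` determine the neighbour, so all degree conditions can be read
off `colorsAt`. -/
theorem ncard_neighborSet (S : ColoredForest n Δ κ) (v : Fin n) :
    (S.graph.neighborSet v).ncard = (S.colorsAt v).card := by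
  classical
  symm
  rw [← Set.ncard_coe_finset]
  have h : ∀ d ∈ S.colorsAt v, ∃ w, S.color s(v, w) = some d := fun d => mem_colorsAt.1
  have : Nonempty (Fin n) := ⟨v⟩
  choose! f hf using h
  refine Set.ncard_congr (fun d _ => f d) (fun d hd => ?_) (fun a b ha hb hab => ?_)
    (fun w hw => ?_)
  · exact S.adj_iff.2 ⟨d, hf d hd⟩
  · have h₁ := hf a ha
    have h₂ := hf b hb
    rw [hab] at h₁
    exact Option.some_injective _ (h₁.symm.trans h₂)
  · obtain ⟨d, hd⟩ := S.adj_iff.1 hw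
    have hd' : d ∈ S.colorsAt v := mem_colorsAt.2 ⟨w, hd⟩
    exact ⟨d, hd', eq_of_color_eq (hf d hd') hd⟩

theorem card_colorsAt_le (S : ColoredForest n Δ κ) (v : Fin n) : (S.colorsAt v).card ≤ Δ :=
  S.ncard_neighborSet v ▸ S.degree_le v

/-- The edge `uv` can be inserted with the colour `d` without recolouring anything. -/
structure CanAdd (S : ColoredForest n Δ κ) (u v : Fin n) (d : Fin κ) : Prop where
  not_reachable : ¬ S.graph.Reachable u v
  card_left : (S.colorsAt u).card < Δ
  card_right : (S.colorsAt v).card < Δ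
  left : d ∉ S.colorsAt u
  right : d ∉ S.colorsAt v

theorem neighborSet_sup_edge {V : Type*} (G : SimpleGraph V) {u v : V} (h : u ≠ v) (w : V) :
    (G ⊔ SimpleGraph.edge u v).neighborSet w =
      {z | G.Adj w z ∨ (w = u ∧ z = v) ∨ (w = v ∧ z = u)} := by
  ext z
  simp only [SimpleGraph.mem_neighborSet, SimpleGraph.sup_adj, SimpleGraph.edge_adj,
    Set.mem_ofPred_eq]
  constructor
  · rintro (h1 | ⟨h1, -⟩)
    · exact .inl h1
    · exact .inr (by tauto)
  · rintro (h1 | ⟨rfl, rfl⟩ | ⟨rfl, rfl⟩)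
    · exact .inl h1
    · exact .inr ⟨by tauto, h⟩
    · exact .inr ⟨by tauto, h.symm⟩

theorem degree_sup_edge_le (S : ColoredForest n Δ κ) {u v : Fin n} (h : u ≠ v)
    (hu : (S.colorsAt u).card < Δ) (hv : (S.colorsAt v).card < Δ) (w : Fin n) :
    ((S.graph ⊔ SimpleGraph.edge u v).neighborSet w).ncard ≤ Δ := by
  rw [neighborSet_sup_edge _ h]
  by_cases hwu : w = u
  · subst hwu
    refine (Set.ncard_le_ncard (t := insert v (S.graph.neighborSet w)) ?_
      (Set.toFinite _)).trans ((Set.ncard_insert_le _ _).trans ?_)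
    · rintro z (hz | ⟨-, rfl⟩ | ⟨rfl, -⟩)
      · exact Or.inr hz
      · exact Or.inl rfl
      · exact absurd rfl h
    · rw [ncard_neighborSet]; omega
  · by_cases hwv : w = v
    · subst hwv
      refine (Set.ncard_le_ncard (t := insert u (S.graph.neighborSet w)) ?_
        (Set.toFinite _)).trans ((Set.ncard_insert_le _ _).trans ?_)
      · rintro z (hz | ⟨rfl, -⟩ | ⟨-, rfl⟩)
        · exact Or.inr hz
        · exact absurd rfl h
        · exact Or.inl rfl
      · rw [ncard_neighborSet]; omega
    · refine (Set.ncard_le_ncard (t := S.graph.neighborSet w) ?_ (Set.toFinite _)).trans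
        (S.degree_le w)
      rintro z (hz | ⟨rfl, -⟩ | ⟨rfl, -⟩)
      · exact hz
      · exact absurd rfl hwu
      · exact absurd rfl hwv

theorem CanAdd.ne {u v : Fin n} {d : Fin κ} (h : S.CanAdd u v d) : u ≠ v := by
  rintro rfl
  exact h.not_reachable (SimpleGraph.Reachable.refl _)

/-- Insert an edge with a given colour. -/
noncomputable def addEdge (S : ColoredForest n Δ κ) (u v : Fin n) (d : Fin κ)
    (h : S.CanAdd u v d) : ColoredForest n Δ κ where
  graph := S.graph ⊔ SimpleGraph.edge u v
  color := Function.update S.color s(u, v) (some d)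
  isAcyclic := S.isAcyclic.sup_edge_of_not_reachable h.not_reachable
  degree_le := S.degree_sup_edge_le h.ne h.card_left h.card_right
  isSome_color := by
    intro e
    rw [SimpleGraph.edgeSet_sup, SimpleGraph.edgeSet_edge_of_ne h.ne]
    by_cases he : e = s(u, v)
    · subst he; simp
    · simp [he, S.isSome_color]
  proper := by
    have key : ∀ a b x : Fin n, S.graph.Adj a b → s(a, b) ≠ s(u, v) → s(a, x) = s(u, v) →
        S.color s(a, b) ≠ some d := by
      intro a b x hab _ hax hcol
      rw [Sym2.eq_iff] at hax
      rcases hax with ⟨rfl, rfl⟩ | ⟨rfl, rfl⟩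
      · exact h.left (mem_colorsAt.2 ⟨b, hcol⟩)
      · exact h.right (mem_colorsAt.2 ⟨b, hcol⟩)
    intro a b c hab hac hbc
    have hb : a ≠ b := hab.ne
    have hc : a ≠ c := hac.ne
    have hab' : s(a, b) = s(u, v) ∨ S.graph.Adj a b := by
      rcases hab with hab | hab
      · exact .inr hab
      · rw [SimpleGraph.edge_adj] at hab
        exact .inl (by rw [Sym2.eq_iff]; tauto)
    have hac' : s(a, c) = s(u, v) ∨ S.graph.Adj a c := by
      rcases hac with hac | hac
      · exact .inr hac
      · rw [SimpleGraph.edge_adj] at hac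
        exact .inl (by rw [Sym2.eq_iff]; tauto)
    by_cases h₁ : s(a, b) = s(u, v)
    · by_cases h₂ : s(a, c) = s(u, v)
      · exact absurd (Sym2.congr_right.1 (h₁.trans h₂.symm)) hbc
      · rw [Function.update_of_ne h₂, h₁, Function.update_self]
        exact (key a c b (hac'.resolve_left h₂) h₂ h₁).symm
    · by_cases h₂ : s(a, c) = s(u, v)
      · rw [Function.update_of_ne h₁, h₂, Function.update_self]
        exact key a b c (hab'.resolve_left h₁) h₁ h₂
      · rw [Function.update_of_ne h₁, Function.update_of_ne h₂]
        exact S.proper a b c (hab'.resolve_left h₁) (hac'.resolve_left h₂) hbc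

@[simp]
theorem addEdge_color {u v : Fin n} {d : Fin κ} (h : S.CanAdd u v d) :
    (S.addEdge u v d h).color = Function.update S.color s(u, v) (some d) := rfl

/-- Delete an edge. -/
noncomputable def deleteEdge (S : ColoredForest n Δ κ) (u v : Fin n) : ColoredForest n Δ κ where
  graph := S.graph.deleteEdges {s(u, v)}
  color := Function.update S.color s(u, v) none
  isAcyclic := S.isAcyclic.anti (SimpleGraph.deleteEdges_le _)
  degree_le := fun w => (Set.ncard_le_ncard (fun z hz => SimpleGraph.deleteEdges_le _ hz)
    (Set.toFinite _)).trans (S.degree_le w)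
  isSome_color := by
    intro e
    rw [SimpleGraph.edgeSet_deleteEdges]
    by_cases he : e = s(u, v)
    · subst he; simp
    · simp [he, S.isSome_color]
  proper := by
    intro a b c hab hac hbc
    rw [SimpleGraph.deleteEdges_adj, Set.mem_singleton_iff] at hab hac
    rw [Function.update_of_ne hab.2, Function.update_of_ne hac.2]
    exact S.proper a b c hab.1 hac.1 hbc

@[simp]
theorem deleteEdge_color (S : ColoredForest n Δ κ) (u v : Fin n) :
    (S.deleteEdge u v).color = Function.update S.color s(u, v) none := rfl

/-- Replace the colouring of a forest. -/
def recolor (S : ColoredForest n Δ κ) (c : Sym2 (Fin n) → Option (Fin κ))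
    (hc : ∀ e, (c e).isSome ↔ (S.color e).isSome)
    (hp : ∀ u v w d, c s(u, v) = some d → c s(u, w) = some d → v = w) : ColoredForest n Δ κ where
  graph := S.graph
  color := c
  isAcyclic := S.isAcyclic
  degree_le := S.degree_le
  isSome_color := fun e => (hc e).trans (S.isSome_color e)
  proper := by
    intro u v w huv huw hvw heq
    obtain ⟨d, hd⟩ := Option.isSome_iff_exists.1 ((hc s(u, v)).2 ((S.isSome_color _).2 huv))
    exact hvw (hp u v w d hd (heq ▸ hd))

theorem recourse_eq_zero_iff :
    recourse S T = 0 ↔ ∀ e ∈ S.graph.edgeSet, e ∈ T.graph.edgeSet → S.color e = T.color e := by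
  rw [recourse, Set.ncard_eq_zero (Set.toFinite _), Set.eq_empty_iff_forall_notMem]
  simp only [Set.mem_ofPred_eq]
  refine forall_congr' fun e => ?_
  tauto

theorem recourse_addEdge {u v : Fin n} {d : Fin κ} (h : S.CanAdd u v d) :
    recourse S (S.addEdge u v d h) = 0 := by
  rw [recourse_eq_zero_iff]
  intro e he _
  rw [addEdge_color, Function.update_of_ne]
  rintro rfl
  exact h.not_reachable (SimpleGraph.Adj.reachable he)

theorem CanAdd.admissible {u v : Fin n} {d : Fin κ} (h : S.CanAdd u v d) :
    (Update.insert u v).Admissible Δ S.graph :=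
  ⟨h.ne, fun h' => h.not_reachable h'.reachable, (S.addEdge u v d h).isAcyclic,
    (S.addEdge u v d h).degree_le⟩

theorem CanAdd.greedyStep {u v : Fin n} {d : Fin κ} (h : S.CanAdd u v d) :
    GreedyStep S (.insert u v) (S.addEdge u v d h) :=
  ⟨h.admissible, rfl, fun T' _ => by rw [recourse_addEdge]; exact Nat.zero_le _⟩

/-- One free colour already makes the optimal recourse zero, so all old colours stay. The only
freedom of the algorithm is the colour of the new edge. -/
theorem eq_addEdge_of_greedyStep {u v : Fin n} {d : Fin κ} (h : S.CanAdd u v d)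
    (hT : GreedyStep S (.insert u v) T) :
    ∃ (d' : Fin κ) (h' : S.CanAdd u v d'), T = S.addEdge u v d' h' := by
  obtain ⟨-, hg, hmin⟩ := hT
  have hg' : T.graph = S.graph ⊔ SimpleGraph.edge u v := hg
  have h0 : recourse S T = 0 :=
    Nat.le_zero.1 ((hmin (S.addEdge u v d h) hg.symm).trans (recourse_addEdge h).le)
  rw [recourse_eq_zero_iff] at h0
  have hle : S.graph ≤ T.graph := hg' ▸ le_sup_left
  have hnone : S.color s(u, v) = none :=
    S.color_eq_none_iff.2 fun h' => h.not_reachable h'.reachable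
  have hold : ∀ e d', S.color e = some d' → T.color e = some d' := by
    intro e d' he
    have he' : e ∈ S.graph.edgeSet := by rw [← S.isSome_color, he]; rfl
    rw [← h0 e he' (SimpleGraph.edgeSet_subset_edgeSet.2 hle he'), he]
  have huv : T.graph.Adj u v := by
    rw [hg']; exact Or.inr ((SimpleGraph.edge_adj _ _ _ _).2 ⟨by tauto, h.ne⟩)
  obtain ⟨d', hd'⟩ := T.adj_iff.1 huv
  have h' : S.CanAdd u v d' := by
    refine ⟨h.not_reachable, h.card_left, h.card_right, fun hm => ?_, fun hm => ?_⟩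
    · obtain ⟨w, hw⟩ := mem_colorsAt.1 hm
      have := eq_of_color_eq (hold _ _ hw) hd'
      subst this; simp [hnone] at hw
    · obtain ⟨w, hw⟩ := mem_colorsAt.1 hm
      have := eq_of_color_eq (hold _ _ hw) (Sym2.eq_swap ▸ hd' : T.color s(v, u) = some d')
      subst this; rw [Sym2.eq_swap, hnone] at hw; simp at hw
  refine ⟨d', h', color_ext ?_⟩
  funext e
  rw [addEdge_color]
  by_cases he : e = s(u, v)
  · subst he; simp [hd']
  · rw [Function.update_of_ne he]
    cases hc : S.color e with
    | some x => exact hold _ _ hc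
    | none =>
      rw [← Option.not_isSome_iff_eq_none, T.isSome_color, hg', SimpleGraph.edgeSet_sup,
        SimpleGraph.edgeSet_edge_of_ne h.ne]
      have : e ∉ S.graph.edgeSet := by rw [← S.isSome_color, hc]; simp
      simp [he, this]

theorem greedyStep_deleteEdge {u v : Fin n} (h : S.graph.Adj u v) :
    GreedyStep S (.delete u v) (S.deleteEdge u v) := by
  refine ⟨h, rfl, fun e he => ?_⟩
  rw [deleteEdge_color, Function.update_of_ne]
  rintro rfl
  simp [deleteEdge, SimpleGraph.edgeSet_deleteEdges] at he

theorem eq_deleteEdge_of_greedyStep {u v : Fin n} (hT : GreedyStep S (.delete u v) T) :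
    T = S.deleteEdge u v := by
  obtain ⟨-, hg, hc⟩ := hT
  have hg' : T.graph = S.graph.deleteEdges {s(u, v)} := hg
  refine color_ext (funext fun e => ?_)
  rw [deleteEdge_color]
  by_cases he : e ∈ T.graph.edgeSet
  · rw [hc e he, Function.update_of_ne]
    rintro rfl
    rw [hg', SimpleGraph.edgeSet_deleteEdges] at he
    simp at he
  · have h1 : T.color e = none := by rwa [← Option.not_isSome_iff_eq_none, T.isSome_color]
    rw [h1]
    by_cases heq : e = s(u, v)
    · simp [heq]
    · rw [Function.update_of_ne heq]
      rw [hg', SimpleGraph.edgeSet_deleteEdges] at he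
      symm
      rw [← Option.not_isSome_iff_eq_none, S.isSome_color]
      simpa [heq] using he

theorem deleteEdge_addEdge {u v : Fin n} {d : Fin κ} (h : S.CanAdd u v d) :
    (S.addEdge u v d h).deleteEdge u v = S := by
  refine color_ext ?_
  have : S.color s(u, v) = none :=
    S.color_eq_none_iff.2 fun h' => h.not_reachable h'.reachable
  rw [deleteEdge_color, addEdge_color, Function.update_idem, ← this, Function.update_eq_self]

end ColoredForest

/-! ### Rigid subtrees. -/

namespace ColoredForest

variable {n Δ κ : ℕ} {S T : ColoredForest n Δ κ}

/-- The edges whose recolouring `recourse` counts. -/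
def changed (S T : ColoredForest n Δ κ) : Set (Sym2 (Fin n)) :=
  {e | e ∈ S.graph.edgeSet ∧ e ∈ T.graph.edgeSet ∧ S.color e ≠ T.color e}

theorem mem_changed {a b : Fin n} {r t : Fin κ}
    (hr : S.color s(a, b) = some r) (ht : T.color s(a, b) = some t) (hrt : r ≠ t) :
    s(a, b) ∈ changed S T :=
  ⟨S.adj_iff.2 ⟨r, hr⟩, T.adj_iff.2 ⟨t, ht⟩, by rw [hr, ht]; simpa using hrt⟩

theorem exists_color_of_le (hle : S.graph ≤ T.graph) {a b : Fin n} {r : Fin κ}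
    (hr : S.color s(a, b) = some r) : ∃ t, T.color s(a, b) = some t :=
  T.adj_iff.1 (hle (S.adj_iff.2 ⟨r, hr⟩))

theorem length_le_recourse {a b : Fin n} {q : T.graph.Walk a b} (hq : q.IsPath)
    (hc : ∀ e ∈ q.edges, e ∈ changed S T) : q.length ≤ recourse S T := by
  classical
  rw [← q.length_edges, ← List.toFinset_card_of_nodup hq.isTrail.edges_nodup,
    ← Set.ncard_coe_finset]
  refine Set.ncard_le_ncard (fun e he => ?_) (Set.toFinite _)
  exact hc e (by simpa using he)

/-- If `X` is the set of colours of the edges from `y` to its children, and a colour of `X` is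
given to another edge at `y`, then some child edge gets a colour outside `X`. -/
theorem exists_color_notMem (hle : S.graph ≤ T.graph) {X : Finset (Fin κ)} {p y : Fin n}
    (hX : ∀ r ∈ X, ∃ z, z ≠ p ∧ S.color s(y, z) = some r) {s : Fin κ} (hs : s ∈ X)
    (hp : T.color s(y, p) = some s) :
    ∃ r ∈ X, ∃ z t, S.color s(y, z) = some r ∧ T.color s(y, z) = some t ∧ t ∉ X := by
  by_contra! hcon
  have h : ∀ r ∈ X, ∃ t, t ∈ X.erase s ∧ ∃ z, S.color s(y, z) = some r ∧
      T.color s(y, z) = some t := by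
    intro r hr
    obtain ⟨z, hzp, hz⟩ := hX r hr
    obtain ⟨t, ht⟩ := exists_color_of_le hle hz
    refine ⟨t, Finset.mem_erase.2 ⟨?_, hcon r hr z t hz ht⟩, z, hz, ht⟩
    rintro rfl
    exact hzp (eq_of_color_eq ht hp)
  have : Nonempty (Fin κ) := ⟨s⟩
  choose! f hf using h
  have hinj : Set.InjOn f X := by
    intro a ha b hb hab
    obtain ⟨z, hz, hzt⟩ := (hf a ha).2
    obtain ⟨w, hw, hwt⟩ := (hf b hb).2
    rw [hab] at hzt
    rw [eq_of_color_eq hzt hwt, hw] at hz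
    exact (Option.some_injective _ hz).symm
  have h1 := Finset.card_le_card_of_injOn f (fun a ha => (hf a ha).1) hinj
  have h2 := Finset.card_erase_lt_of_mem hs
  omega

/-- The subtree at `y` away from `p` is rigid to depth `k`: the child edges at `y` have the colours
in `X`, and every colour outside `X` is blocked at the children in the same way. -/
def Rigid (S : ColoredForest n Δ κ) : ℕ → Finset (Fin κ) → Fin n → Fin n → Prop
  | 0, _, _, _ => True
  | k + 1, X, p, y => ∀ r ∈ X, ∃ z, z ≠ p ∧ S.color s(y, z) = some r ∧
      ∃ Y, Xᶜ ⊆ Y ∧ Rigid S k Y y z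

/-- The child edge found by `exists_color_notMem` has a new colour in `Xᶜ ⊆ Y`, which is the
hypothesis again one level down. Avoidance of `p` is carried along so that the pieces concatenate to
a path, whose edges are distinct and can be counted. -/
theorem Rigid.exists_walk (hle : S.graph ≤ T.graph) :
    ∀ {k : ℕ} {X : Finset (Fin κ)} {p y : Fin n}, S.Rigid k X p y → ∀ {s : Fin κ}, s ∈ X →
      T.color s(y, p) = some s →
      ∃ (z : Fin n) (q : T.graph.Walk y z), q.IsPath ∧ q.length = k ∧ p ∉ q.support ∧
        ∀ e ∈ q.edges, e ∈ changed S T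
  | 0, X, p, y, _, s, _, hp =>
    ⟨y, .nil, by simp, rfl, by simpa using (ne_of_color hp).symm, by simp⟩
  | k + 1, X, p, y, h, s, hs, hp => by
    obtain ⟨r, hr, z, t, hz, ht, htX⟩ := exists_color_notMem hle
      (fun r hr => by obtain ⟨z, hz⟩ := h r hr; exact ⟨z, hz.1, hz.2.1⟩) hs hp
    obtain ⟨z', hzp, hz', Y, hXY, hY⟩ := h r hr
    obtain rfl := eq_of_color_eq hz hz'
    obtain ⟨w, q, hq, hlen, hy, hch⟩ := Rigid.exists_walk hle hY
      (hXY (Finset.mem_compl.2 htX)) (Sym2.eq_swap ▸ ht)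
    have hadj : T.graph.Adj y z := T.adj_iff.2 ⟨t, ht⟩
    have hpath : (SimpleGraph.Walk.cons hadj q).IsPath := hq.cons hy
    refine ⟨w, .cons hadj q, hpath, by simp [hlen], fun hmem => ?_, ?_⟩
    -- In a forest, a path from `y` that meets the neighbour `p` of `y` must step to `p` at once;
    -- but it steps to `z`.
    · have := T.isAcyclic.eq_snd_of_adj_start hpath (T.adj_iff.2 ⟨s, hp⟩) hmem
      exact hzp (by simpa using this.symm)
    · intro e he
      rw [SimpleGraph.Walk.edges_cons, List.mem_cons] at he
      rcases he with rfl | he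
      · exact mem_changed hz ht (fun hrt => htX (hrt ▸ hr))
      · exact hch e he

theorem Rigid.le_recourse (hle : S.graph ≤ T.graph) {k : ℕ} {X : Finset (Fin κ)} {p y : Fin n}
    (h : S.Rigid k X p y) {s : Fin κ} (hs : s ∈ X) (hp : T.color s(y, p) = some s) :
    k ≤ recourse S T := by
  obtain ⟨z, q, hq, hlen, -, hch⟩ := h.exists_walk hle hs hp
  exact hlen ▸ length_le_recourse hq hch

/-! ### Alternating paths and the forced flip. -/

/-- The colours `β, α, β, α, …` -/
def altColor (α β : Fin κ) (i : ℕ) : Fin κ := if Even i then β else α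

/-- The types `X₀, X₁, X₀, X₁, …` -/
def altType (X₀ X₁ : Finset (Fin κ)) (i : ℕ) : Finset (Fin κ) := if Even i then X₀ else X₁

theorem altColor_add_two (α β : Fin κ) (i : ℕ) : altColor α β (i + 2) = altColor α β i := by
  simp [altColor, Nat.even_add]

theorem swap_altColor (α β : Fin κ) (i : ℕ) :
    Equiv.swap α β (altColor α β (i + 1)) = altColor α β i := by
  by_cases h : Even i <;> simp [altColor, h, Nat.even_add_one]

/-- Two types and two colours such that paths coloured alternately with the two colours, through
vertices alternately of the two types, can be flipped but are rigid otherwise. -/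
structure IsAlternating (X₀ X₁ : Finset (Fin κ)) (α β : Fin κ) : Prop where
  union : X₀ᶜ ⊆ X₁
  left_mem : α ∈ X₀
  left_notMem : α ∉ X₁
  right_mem : β ∈ X₁
  right_notMem : β ∉ X₀

namespace IsAlternating

variable {X₀ X₁ : Finset (Fin κ)} {α β : Fin κ} (hA : IsAlternating X₀ X₁ α β)
include hA

theorem compl_subset (i : ℕ) : (altType X₀ X₁ i)ᶜ ⊆ altType X₀ X₁ (i + 1) := by
  by_cases h : Even i
  · simpa [altType, h, Nat.even_add_one] using hA.union
  · simpa [altType, h, Nat.even_add_one] using compl_le_iff_compl_le.1 hA.union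

theorem mem (i : ℕ) : altColor α β (i + 1) ∈ altType X₀ X₁ i := by
  by_cases h : Even i
  · simpa [altType, altColor, h, Nat.even_add_one] using hA.left_mem
  · simpa [altType, altColor, h, Nat.even_add_one] using hA.right_mem

theorem notMem (i : ℕ) : altColor α β i ∉ altType X₀ X₁ i := by
  by_cases h : Even i
  · simpa [altType, altColor, h] using hA.right_notMem
  · simpa [altType, altColor, h] using hA.left_notMem

end IsAlternating

/-- The edges of the path `x 0, …, x D`. -/
def pathEdges (x : ℕ → Fin n) (D : ℕ) : Finset (Sym2 (Fin n)) :=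
  (Finset.range D).image fun i => s(x i, x (i + 1))

theorem mem_pathEdges {x : ℕ → Fin n} {D : ℕ} {e : Sym2 (Fin n)} :
    e ∈ pathEdges x D ↔ ∃ i < D, s(x i, x (i + 1)) = e := by
  simp [pathEdges]

/-- Exchange two colours on a set of edges. -/
def flipColor (S : ColoredForest n Δ κ) (E : Finset (Sym2 (Fin n))) (α β : Fin κ)
    (e : Sym2 (Fin n)) : Option (Fin κ) :=
  if e ∈ E then (S.color e).map (Equiv.swap α β) else S.color e

/-- A path `x 0, …, x D` coloured alternately with `α` and `β`, in a rigid surrounding, and a vertex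
`v` in another component such that the insertion of the edge `x 0 — v` makes it necessary to flip
the path. -/
structure ZigZag (S : ColoredForest n Δ κ) (X₀ X₁ : Finset (Fin κ)) (α β : Fin κ) (D : ℕ)
    (x : ℕ → Fin n) (v : Fin n) : Prop where
  pos : 0 < D
  even : Even D
  alt : IsAlternating X₀ X₁ α β
  inj : ∀ i ≤ D, ∀ j ≤ D, x i = x j → i = j
  path : ∀ i < D, S.color s(x i, x (i + 1)) = some (altColor α β (i + 1))
  off : ∀ i ≤ D, ∀ r ∈ altType X₀ X₁ i, r ≠ altColor α β (i + 1) → ∃ y,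
    S.color s(x i, y) = some r ∧ ∃ Y, (altType X₀ X₁ i)ᶜ ⊆ Y ∧ S.Rigid D Y (x i) y
  rigid : S.Rigid (D + 1) X₁ (x 0) v
  ne : ∀ i ≤ D, x i ≠ v
  not_reachable : ¬ S.graph.Reachable (x 0) v
  card_left : (S.colorsAt (x 0)).card < Δ
  card_right : (S.colorsAt v).card < Δ
  left : β ∉ S.colorsAt (x 0)
  right : α ∉ S.colorsAt v
  last : α ∉ S.colorsAt (x D)

namespace ZigZag

variable {X₀ X₁ : Finset (Fin κ)} {α β : Fin κ} {D : ℕ} {x : ℕ → Fin n} {v : Fin n}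
  (h : ZigZag S X₀ X₁ α β D x v)
include h

theorem card_pathEdges : (pathEdges x D).card = D := by
  rw [pathEdges, Finset.card_image_of_injOn, Finset.card_range]
  intro i hi j hj hij
  rw [Finset.coe_range, Set.mem_Iio] at hi hj
  simp only [Sym2.eq_iff] at hij
  rcases hij with ⟨h1, -⟩ | ⟨h1, h2⟩
  · exact h.inj i hi.le j hj.le h1
  · have := h.inj i hi.le (j + 1) hj h1
    have := h.inj (i + 1) hi j hj.le h2
    omega

/-- The edges that leave the path are not on it. -/
theorem off_notMem {i : ℕ} (hi : i ≤ D) {r : Fin κ} (hr : r ∈ altType X₀ X₁ i)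
    (hne : r ≠ altColor α β (i + 1)) {y : Fin n} (hy : S.color s(x i, y) = some r) :
    s(x i, y) ∉ pathEdges x D := by
  rw [mem_pathEdges]
  rintro ⟨k, hk, he⟩
  have hc := h.path k hk
  rw [he, hy] at hc
  have hc' := Option.some_injective _ hc
  rw [Sym2.eq_iff] at he
  rcases he with ⟨h1, -⟩ | ⟨-, h2⟩
  · obtain rfl := h.inj k hk.le i hi h1
    exact hne hc'
  · obtain rfl := h.inj (k + 1) hk i hi h2
    exact h.alt.notMem _ (hc' ▸ hr)

theorem exists_child {i : ℕ} (hi : i < D) {r : Fin κ} (hr : r ∈ altType X₀ X₁ i) :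
    ∃ z, S.color s(x i, z) = some r := by
  by_cases hne : r = altColor α β (i + 1)
  · exact ⟨x (i + 1), hne ▸ h.path i hi⟩
  · obtain ⟨y, hy, -⟩ := h.off i hi.le r hr hne
    exact ⟨y, hy⟩

theorem color_none : S.color s(x 0, v) = none :=
  S.color_eq_none_iff.2 fun h' => h.not_reachable h'.reachable

/-- A change of colour spreads along the path. -/
theorem spread (hle : S.graph ≤ T.graph) (hrec : recourse S T ≤ D) {i : ℕ} (hi : i < D)
    {p : Fin n} {s : Fin κ} (hs : s ∈ altType X₀ X₁ i) (hp : T.color s(x i, p) = some s)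
    (hold : ∀ r ∈ altType X₀ X₁ i, S.color s(x i, p) ≠ some r) :
    ∃ t, T.color s(x i, x (i + 1)) = some t ∧ t ∉ altType X₀ X₁ i := by
  obtain ⟨r, hr, z, t, hz, ht, htX⟩ := exists_color_notMem hle (fun r hr => by
    obtain ⟨z, hz⟩ := h.exists_child hi hr
    exact ⟨z, fun hzp => hold r hr (hzp ▸ hz), hz⟩) hs hp
  by_cases hne : r = altColor α β (i + 1)
  · have := h.path i hi
    rw [← hne] at this
    obtain rfl := eq_of_color_eq this hz
    exact ⟨t, ht, htX⟩
  · exfalso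
    obtain ⟨y, hy, Y, hY, hrig⟩ := h.off i hi.le r hr hne
    obtain rfl := eq_of_color_eq hz hy
    -- Leaving the path recolours this edge and `D` further edges below it, one more than is
    -- allowed.
    obtain ⟨w, q, hq, hlen, hmem, hch⟩ := hrig.exists_walk hle (hY (Finset.mem_compl.2 htX))
      (Sym2.eq_swap ▸ ht)
    have hadj : T.graph.Adj (x i) z := T.adj_iff.2 ⟨t, ht⟩
    have hpath : (SimpleGraph.Walk.cons hadj q).IsPath := hq.cons hmem
    have := length_le_recourse (S := S) hpath (by
      intro e he
      rw [SimpleGraph.Walk.edges_cons, List.mem_cons] at he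
      rcases he with rfl | he
      · exact mem_changed hz ht (fun hrt => htX (hrt ▸ hr))
      · exact hch e he)
    rw [SimpleGraph.Walk.length_cons, hlen] at this
    omega

/-- A colour outside the type of `x i` lies in the type of `x (i + 1)`, so each recoloured path edge
displaces the next one. -/
theorem spread_all (hle : S.graph ≤ T.graph) (hrec : recourse S T ≤ D) {s : Fin κ}
    (hs : s ∈ X₀) (hv : T.color s(x 0, v) = some s) :
    ∀ i < D, ∃ t, T.color s(x i, x (i + 1)) = some t ∧ t ∉ altType X₀ X₁ i
  | 0, hi => h.spread hle hrec hi (by simpa [altType] using hs) hv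
      (fun r _ => by rw [h.color_none]; simp)
  | i + 1, hi => by
    obtain ⟨t, ht, htX⟩ := spread_all hle hrec hs hv i (by omega)
    refine h.spread hle hrec hi (h.alt.compl_subset i (Finset.mem_compl.2 htX))
      (Sym2.eq_swap ▸ ht) (fun r hr hc => ?_)
    have h1 := h.path i (by omega)
    rw [Sym2.eq_swap, hc] at h1
    exact h.alt.notMem _ (Option.some_injective _ h1 ▸ hr)

/-- A colour outside `X₀` lies in `X₁` and would disturb the tree at `v`, which is rigid to depth `D
+ 1`. -/
theorem mem_left (hle : S.graph ≤ T.graph) (hrec : recourse S T ≤ D) {s : Fin κ}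
    (hv : T.color s(x 0, v) = some s) : s ∈ X₀ := by
  by_contra hs
  have := h.rigid.le_recourse hle (h.alt.union (Finset.mem_compl.2 hs)) (Sym2.eq_swap ▸ hv)
  omega

theorem pathEdges_subset_changed (hle : S.graph ≤ T.graph) (hrec : recourse S T ≤ D) {s : Fin κ}
    (hv : T.color s(x 0, v) = some s) : ↑(pathEdges x D) ⊆ changed S T := by
  intro e he
  obtain ⟨i, hi, rfl⟩ := mem_pathEdges.1 (Finset.mem_coe.1 he)
  obtain ⟨t, ht, htX⟩ := h.spread_all hle hrec (h.mem_left hle hrec hv) hv i hi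
  exact mem_changed (h.path i hi) ht fun h' => htX (h' ▸ h.alt.mem i)

/-- All `D` path edges change, which exhausts the budget. -/
theorem changed_eq (hle : S.graph ≤ T.graph) (hrec : recourse S T ≤ D) {s : Fin κ}
    (hv : T.color s(x 0, v) = some s) : changed S T = ↑(pathEdges x D) := by
  symm
  refine Set.eq_of_subset_of_ncard_le (h.pathEdges_subset_changed hle hrec hv) ?_ (Set.toFinite _)
  rw [Set.ncard_coe_finset, h.card_pathEdges]
  exact hrec

theorem le_recourse (hle : S.graph ≤ T.graph) {s : Fin κ}
    (hv : T.color s(x 0, v) = some s) : D ≤ recourse S T := by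
  by_contra! hlt
  have h1 := h.changed_eq hle hlt.le hv
  have h2 : recourse S T = (changed S T).ncard := rfl
  rw [h1, Set.ncard_coe_finset, h.card_pathEdges] at h2
  omega

theorem color_eq_of_notMem (hle : S.graph ≤ T.graph) (hrec : recourse S T ≤ D) {s : Fin κ}
    (hv : T.color s(x 0, v) = some s) {e : Sym2 (Fin n)} (he : e ∉ pathEdges x D) {d : Fin κ}
    (hd : S.color e = some d) : T.color e = some d := by
  rw [← Finset.mem_coe, ← h.changed_eq hle hrec hv] at he
  have heS : e ∈ S.graph.edgeSet := by rw [← S.isSome_color, hd]; rfl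
  by_contra hne
  exact he ⟨heS, SimpleGraph.edgeSet_subset_edgeSet.2 hle heS, by rw [hd]; exact Ne.symm hne⟩

/-- The only colour of its type that may become the colour of the edge towards `x i`. -/
theorem eq_altColor (hle : S.graph ≤ T.graph) (hrec : recourse S T ≤ D) {s : Fin κ}
    (hv : T.color s(x 0, v) = some s) {i : ℕ} (hi : i ≤ D) {p : Fin n} {t : Fin κ}
    (ht : t ∈ altType X₀ X₁ i) (hp : T.color s(x i, p) = some t)
    (hold : ∀ r ∈ altType X₀ X₁ i, S.color s(x i, p) ≠ some r) : t = altColor α β (i + 1) := by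
  by_contra hne
  obtain ⟨y, hy, -⟩ := h.off i hi t ht hne
  have := h.color_eq_of_notMem hle hrec hv (h.off_notMem hi ht hne hy) hy
  exact hold t ht (eq_of_color_eq this hp ▸ hy)

/-- Edges off the path keep their colours. At `x i` they occupy the whole type except `altColor α β
(i + 1)`, so the edge that enters `x i` has to take this colour. The optimum is therefore unique and
ties play no role. -/
theorem color_eq (hg : T.graph = S.graph ⊔ SimpleGraph.edge (x 0) v) (hrec : recourse S T ≤ D) :
    T.color = Function.update (S.flipColor (pathEdges x D) α β) s(x 0, v) (some α) := by
  have hle : S.graph ≤ T.graph := hg ▸ le_sup_left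
  have hne : x 0 ≠ v := h.ne 0 (Nat.zero_le _)
  have hadj : T.graph.Adj (x 0) v := by
    rw [hg]; exact Or.inr ((SimpleGraph.edge_adj _ _ _ _).2 ⟨by tauto, hne⟩)
  obtain ⟨s, hv⟩ := T.adj_iff.1 hadj
  have hs := h.mem_left hle hrec hv
  funext e
  by_cases he : e = s(x 0, v)
  · subst he
    rw [Function.update_self, hv, h.eq_altColor hle hrec hv (Nat.zero_le _) (t := s)
      (by simpa [altType] using hs) hv (fun r _ => by rw [h.color_none]; simp)]
    simp [altColor]
  · rw [Function.update_of_ne he, flipColor]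
    split_ifs with hmem
    · obtain ⟨i, hi, rfl⟩ := mem_pathEdges.1 hmem
      obtain ⟨t, ht, htX⟩ := h.spread_all hle hrec hs hv i hi
      rw [ht, h.path i hi, Option.map_some, swap_altColor, ← altColor_add_two]
      congr 1
      refine h.eq_altColor hle hrec hv hi (h.alt.compl_subset i (Finset.mem_compl.2 htX))
        (Sym2.eq_swap ▸ ht) (fun r hr hc => ?_)
      have h1 := h.path i hi
      rw [Sym2.eq_swap, hc] at h1
      exact h.alt.notMem _ (Option.some_injective _ h1 ▸ hr)
    · cases hc : S.color e with
      | some d => exact h.color_eq_of_notMem hle hrec hv hmem hc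
      | none =>
        rw [← Option.not_isSome_iff_eq_none, T.isSome_color, hg, SimpleGraph.edgeSet_sup,
          SimpleGraph.edgeSet_edge_of_ne hne]
        have : e ∉ S.graph.edgeSet := by rw [← S.isSome_color, hc]; simp
        simp [he, this]

/-- The path is a complete Kempe chain: `β` is missing at `x 0` and, since `D` is even, the chain
could continue at `x D` only with `α`, which is missing there. This makes the flipped colouring
proper. -/
theorem mem_of_flip {u w w' : Fin n} {d : Fin κ} (hw : s(u, w) ∈ pathEdges x D)
    (hd : (S.color s(u, w)).map (Equiv.swap α β) = some d) (hw' : S.color s(u, w') = some d) :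
    s(u, w') ∈ pathEdges x D := by
  obtain ⟨i, hi, he⟩ := mem_pathEdges.1 hw
  rw [← he, h.path i hi, Option.map_some, swap_altColor] at hd
  have hd' := Option.some_injective _ hd
  subst hd'
  rw [Sym2.eq_iff] at he
  rcases he with ⟨rfl, -⟩ | ⟨-, rfl⟩
  · rcases i with _ | i
    · exact absurd (mem_colorsAt.2 ⟨w', by simpa [altColor] using hw'⟩) h.left
    · have := h.path i (by omega)
      rw [Sym2.eq_swap] at this
      obtain rfl := eq_of_color_eq hw' this
      exact mem_pathEdges.2 ⟨i, by omega, Sym2.eq_swap⟩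
  · by_cases hD : i + 1 = D
    · have hodd : ¬ Even i := by
        have := h.even
        rw [← hD, Nat.even_add_one] at this
        exact this
      rw [hD] at hw'
      exact absurd (mem_colorsAt.2 ⟨w', by simpa [altColor, hodd] using hw'⟩) h.last
    · have := h.path (i + 1) (by omega)
      rw [altColor_add_two] at this
      obtain rfl := eq_of_color_eq hw' this
      exact mem_pathEdges.2 ⟨i + 1, by omega, rfl⟩

/-- The forest with the path flipped. -/
def flip : ColoredForest n Δ κ :=
  S.recolor (S.flipColor (pathEdges x D) α β)
    (fun e => by rw [flipColor]; split_ifs <;> simp)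
    (fun u w w' d hw hw' => by
      rw [flipColor] at hw hw'
      split_ifs at hw hw' with h1 h2 h2
      · obtain ⟨a, ha, had⟩ := Option.map_eq_some_iff.1 hw
        obtain ⟨b, hb, hbd⟩ := Option.map_eq_some_iff.1 hw'
        have : a = b := (Equiv.swap α β).injective (had.trans hbd.symm)
        subst this
        exact eq_of_color_eq ha hb
      · exact absurd (h.mem_of_flip h1 hw hw') h2
      · exact absurd (h.mem_of_flip h2 hw' hw) h1
      · exact eq_of_color_eq hw hw')

omit h in
@[simp]
theorem flip_color (h : ZigZag S X₀ X₁ α β D x v) :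
    h.flip.color = S.flipColor (pathEdges x D) α β := rfl

omit h in
@[simp]
theorem flip_graph (h : ZigZag S X₀ X₁ α β D x v) : h.flip.graph = S.graph := rfl

theorem card_colorsAt_flip (w : Fin n) : (h.flip.colorsAt w).card = (S.colorsAt w).card := by
  rw [← ncard_neighborSet, ← ncard_neighborSet, flip_graph]

theorem right_notMem_pathEdges (w : Fin n) : s(v, w) ∉ pathEdges x D := by
  rw [mem_pathEdges]
  rintro ⟨i, hi, he⟩
  rw [Sym2.eq_iff] at he
  rcases he with ⟨h1, -⟩ | ⟨-, h1⟩
  · exact h.ne i hi.le h1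
  · exact h.ne (i + 1) hi h1

theorem left_notMem_colorsAt_flip : α ∉ h.flip.colorsAt (x 0) := by
  intro hm
  obtain ⟨w, hw⟩ := mem_colorsAt.1 hm
  rw [flip_color, flipColor] at hw
  split_ifs at hw with h1
  · obtain ⟨a, ha, had⟩ := Option.map_eq_some_iff.1 hw
    have : a = β := 
      (Equiv.swap α β).injective (had.trans (Equiv.swap_apply_right α β).symm)
    subst this
    exact h.left (mem_colorsAt.2 ⟨w, ha⟩)
  · have := h.path 0 h.pos
    simp only [altColor, zero_add, Nat.not_even_one, if_false] at this
    obtain rfl := eq_of_color_eq hw this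
    exact h1 (mem_pathEdges.2 ⟨0, h.pos, rfl⟩)

theorem right_notMem_colorsAt_flip : α ∉ h.flip.colorsAt v := by
  intro hm
  obtain ⟨w, hw⟩ := mem_colorsAt.1 hm
  rw [flip_color, flipColor, if_neg (h.right_notMem_pathEdges w)] at hw
  exact h.right (mem_colorsAt.2 ⟨w, hw⟩)

theorem canAdd_flip : h.flip.CanAdd (x 0) v α :=
  ⟨h.not_reachable, h.card_colorsAt_flip _ ▸ h.card_left, h.card_colorsAt_flip _ ▸ h.card_right,
    h.left_notMem_colorsAt_flip, h.right_notMem_colorsAt_flip⟩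

theorem recourse_flip_le : recourse S (h.flip.addEdge (x 0) v α h.canAdd_flip) ≤ D := by
  refine le_of_le_of_eq ?_ h.card_pathEdges
  rw [← Set.ncard_coe_finset]
  refine Set.ncard_le_ncard ?_ (Set.toFinite _)
  rintro e ⟨heS, -, hne⟩
  by_contra he
  rw [Finset.mem_coe] at he
  rw [addEdge_color, Function.update_of_ne, flip_color, flipColor, if_neg he] at hne
  · exact hne rfl
  · rintro rfl
    exact h.not_reachable (SimpleGraph.Adj.reachable heS)

theorem greedyStep_flip :
    GreedyStep S (.insert (x 0) v) (h.flip.addEdge (x 0) v α h.canAdd_flip) := by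
  refine ⟨h.canAdd_flip.admissible, rfl, fun T' hT' => h.recourse_flip_le.trans ?_⟩
  have hg : T'.graph = S.graph ⊔ SimpleGraph.edge (x 0) v := hT'
  have hadj : T'.graph.Adj (x 0) v := by
    rw [hg]; exact Or.inr ((SimpleGraph.edge_adj _ _ _ _).2 ⟨by tauto, h.canAdd_flip.ne⟩)
  obtain ⟨s, hs⟩ := T'.adj_iff.1 hadj
  exact h.le_recourse (hg ▸ le_sup_left) hs

theorem eq_of_greedyStep (hT : GreedyStep S (.insert (x 0) v) T) :
    T = h.flip.addEdge (x 0) v α h.canAdd_flip ∧ D ≤ recourse S T := by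
  have hg : T.graph = S.graph ⊔ SimpleGraph.edge (x 0) v := hT.2.1
  have hrec : recourse S T ≤ D :=
    (hT.2.2 (h.flip.addEdge (x 0) v α h.canAdd_flip) hg.symm).trans h.recourse_flip_le
  have hadj : T.graph.Adj (x 0) v := by
    rw [hg]; exact Or.inr ((SimpleGraph.edge_adj _ _ _ _).2 ⟨by tauto, h.canAdd_flip.ne⟩)
  obtain ⟨s, hs⟩ := T.adj_iff.1 hadj
  exact ⟨color_ext (h.color_eq hg hrec), h.le_recourse (hg ▸ le_sup_left) hs⟩

end ZigZag

/-! ### Runs whose outcome does not depend on ties. -/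

/-- Serving the updates `as` greedily leads from `S` to `T` however ties are broken, with recourse
at least `r`. -/
def Forced (S : ColoredForest n Δ κ) (as : List (Update n)) (r : ℕ)
    (T : ColoredForest n Δ κ) : Prop :=
  (∃ r' T', GreedyRun S as r' T') ∧ ∀ r' T', GreedyRun S as r' T' → T' = T ∧ r ≤ r'

theorem Forced.nil (S : ColoredForest n Δ κ) : Forced S [] 0 S :=
  ⟨⟨0, S, rfl, rfl⟩, fun _ _ h => ⟨h.2, Nat.zero_le _⟩⟩

theorem Forced.cons {S' : ColoredForest n Δ κ} {a : Update n} {as : List (Update n)} {r r' : ℕ}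
    (hex : GreedyStep S a S') (hun : ∀ T', GreedyStep S a T' → T' = S' ∧ r ≤ recourse S T')
    (h : Forced S' as r' T) : Forced S (a :: as) (r + r') T := by
  obtain ⟨⟨r₁, T₁, h₁⟩, h₂⟩ := h
  refine ⟨⟨_, T₁, S', r₁, hex, h₁, rfl⟩, ?_⟩
  rintro r₃ T₃ ⟨S₃, r₄, hstep, hrun, rfl⟩
  obtain ⟨rfl, hr⟩ := hun _ hstep
  obtain ⟨rfl, hr'⟩ := h₂ _ _ hrun
  exact ⟨rfl, add_le_add hr hr'⟩

theorem greedyRun_append {as bs : List (Update n)} {r : ℕ} :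
    ∀ {S T : ColoredForest n Δ κ}, GreedyRun S (as ++ bs) r T ↔
      ∃ S' r₁ r₂, GreedyRun S as r₁ S' ∧ GreedyRun S' bs r₂ T ∧ r = r₁ + r₂ := by
  induction as generalizing r with
  | nil =>
    intro S T
    constructor
    · intro h; exact ⟨S, 0, r, ⟨rfl, rfl⟩, h, by omega⟩
    · rintro ⟨S', r₁, r₂, ⟨rfl, rfl⟩, h, rfl⟩; simpa using h
  | cons a as ih =>
    intro S T
    constructor
    · rintro ⟨S₁, r₁, hs, hr, rfl⟩
      obtain ⟨S', r₂, r₃, h₂, h₃, rfl⟩ := ih.1 hr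
      exact ⟨S', _, r₃, ⟨S₁, r₂, hs, h₂, rfl⟩, h₃, by omega⟩
    · rintro ⟨S', r₁, r₂, ⟨S₁, r₃, hs, h₃, rfl⟩, h₂, rfl⟩
      exact ⟨S₁, r₃ + r₂, hs, ih.2 ⟨S', r₃, r₂, h₃, h₂, rfl⟩, by omega⟩

theorem Forced.append {S' : ColoredForest n Δ κ} {as bs : List (Update n)} {r r' : ℕ}
    (h₁ : Forced S as r S') (h₂ : Forced S' bs r' T) : Forced S (as ++ bs) (r + r') T := by
  constructor
  · obtain ⟨⟨r₁, T₁, h⟩, hu⟩ := h₁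
    obtain ⟨⟨r₂, T₂, h'⟩, -⟩ := h₂
    obtain ⟨rfl, -⟩ := hu _ _ h
    exact ⟨_, T₂, greedyRun_append.2 ⟨_, _, _, h, h', rfl⟩⟩
  · intro r₃ T₃ h
    obtain ⟨S₁, r₁, r₂, ha, hb, rfl⟩ := greedyRun_append.1 h
    obtain ⟨rfl, hr₁⟩ := h₁.2 _ _ ha
    obtain ⟨rfl, hr₂⟩ := h₂.2 _ _ hb
    exact ⟨rfl, add_le_add hr₁ hr₂⟩

theorem Forced.replicate {as : List (Update n)} {r : ℕ} (h : Forced S as r S) :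
    ∀ k, Forced S (List.replicate k as).flatten (k * r) S
  | 0 => by simpa using Forced.nil S
  | k + 1 => by
    rw [List.replicate_succ, List.flatten_cons, Nat.succ_mul, add_comm]
    exact h.append (Forced.replicate h k)

theorem Forced.isBadState {as : List (Update n)} {r : ℕ} (h : Forced S as r S)
    (hlen : as.length = 6) {B : ℝ} (hB : 6 * B ≤ r) : IsBadState S B := by
  refine ⟨as, hlen, fun k => ⟨(h.replicate k).1, fun r' T hT => ?_⟩⟩
  obtain ⟨rfl, hr⟩ := (h.replicate k).2 r' T hT
  refine ⟨rfl, ?_⟩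
  have h1 : ((k * r : ℕ) : ℝ) ≤ r' := by exact_mod_cast hr
  push_cast at h1
  have h2 : (k : ℝ) * (6 * B) ≤ k * r := mul_le_mul_of_nonneg_left hB (Nat.cast_nonneg k)
  linarith

/-- The deletion erases whatever colour was chosen. This pads the four essential updates of the
cycle to six. -/
theorem forced_insert_delete {u v : Fin n} {d : Fin κ} (h : S.CanAdd u v d) :
    Forced S [.insert u v, .delete u v] 0 S := by
  have hex : (S.addEdge u v d h).graph.Adj u v := by
    rw [adj_iff]; exact ⟨d, by simp⟩
  constructor
  · exact ⟨_, _, _, _, h.greedyStep, ⟨_, _, greedyStep_deleteEdge hex, ⟨rfl, rfl⟩, rfl⟩, rfl⟩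
  · rintro r T ⟨S₁, r₁, h₁, ⟨S₂, r₂, h₂, ⟨-, rfl⟩, rfl⟩, rfl⟩
    obtain ⟨d', h', rfl⟩ := eq_addEdge_of_greedyStep h h₁
    refine ⟨?_, Nat.zero_le _⟩
    rw [eq_deleteEdge_of_greedyStep h₂, deleteEdge_addEdge]

theorem ZigZag.forced {X₀ X₁ : Finset (Fin κ)} {α β : Fin κ} {D : ℕ} {x : ℕ → Fin n} {v : Fin n}
    (h : ZigZag S X₀ X₁ α β D x v) :
    Forced S [.insert (x 0) v, .delete (x 0) v] D h.flip := by
  have hadj : (h.flip.addEdge (x 0) v α h.canAdd_flip).graph.Adj (x 0) v := by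
    rw [adj_iff]; exact ⟨α, by simp⟩
  refine Forced.cons (r' := 0) h.greedyStep_flip (fun T hT => h.eq_of_greedyStep hT) ?_
  refine Forced.cons (r' := 0) (r := 0) (S' := h.flip) ?_ (fun T hT => ?_) (Forced.nil _)
  · have := greedyStep_deleteEdge hadj
    rwa [deleteEdge_addEdge] at this
  · rw [eq_deleteEdge_of_greedyStep hT, deleteEdge_addEdge]
    exact ⟨rfl, Nat.zero_le _⟩

end ColoredForest

/-! ### Type systems. -/

section Types

variable {κ : ℕ}

/-- An assignment of types (the sets of the colours of the child edges of a vertex) to the children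
of a vertex of type `X`, such that the resulting trees are rigid and can be put together greedily. -/
structure IsTypeSystem (Δ : ℕ) (child : Finset (Fin κ) → Fin κ → Finset (Fin κ)) : Prop where
  card : ∀ X r, X.card + 1 = Δ → r ∈ X → (child X r).card + 1 = Δ
  notMem : ∀ X r, X.card + 1 = Δ → r ∈ X → r ∉ child X r
  compl : ∀ X r, X.card + 1 = Δ → r ∈ X → Xᶜ ⊆ child X r
  exists_next : ∀ X Z, X.card + 1 = Δ → Z ⊂ X →
    ∃ r ∈ X, r ∉ Z ∧ ∀ d ∈ X, d ∉ Z → d ∉ child X r → child X d = child X r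

/-- The complement of a child's type consists of the `c + 1` colours that the edge to it may
receive. While `F X` is not used up, children with complement `F X` are attached, and every possible
colour asks for this same type. Once `F X ⊆ Z`, the complement consists of `r` and used colours, so
the new edge is forced to have colour `r`. -/
theorem exists_isTypeSystem_of_core {Δ c : ℕ} (hκ : κ = Δ + c) (F : Finset (Fin κ) → Finset (Fin κ))
    (f : Finset (Fin κ) → Fin κ) (hF : ∀ X, X.card + 1 = Δ → F X ⊆ X ∧ (F X).card = c + 1)
    (hf : ∀ X, X.card + 1 = Δ → f X ∈ F X) :
    IsTypeSystem Δ (fun X r => (if r ∈ F X then F X else insert r ((F X).erase (f X)))ᶜ) := by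
  have hmem : ∀ X r, r ∈ (if r ∈ F X then F X else insert r ((F X).erase (f X))) := by
    intro X r; split_ifs with h
    · exact h
    · simp
  refine ⟨fun X r hX hr => ?_, fun X r hX hr => ?_, fun X r hX hr => ?_, fun X Z hX hZ => ?_⟩
  · have hcard : (if r ∈ F X then F X else insert r ((F X).erase (f X))).card = c + 1 := by
      split_ifs with h
      · exact (hF X hX).2
      · rw [Finset.card_insert_of_notMem (fun h' => h (Finset.mem_of_mem_erase h')),
          Finset.card_erase_of_mem (hf X hX), (hF X hX).2]; rfl
    rw [Finset.card_compl, hcard, Fintype.card_fin]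
    have := Finset.card_le_card (hF X hX).1
    rw [(hF X hX).2] at this
    omega
  · simpa using hmem X r
  · rw [Finset.compl_subset_compl]
    split_ifs with h
    · exact (hF X hX).1
    · exact Finset.insert_subset hr ((Finset.erase_subset _ _).trans (hF X hX).1)
  · by_cases hFZ : F X ⊆ Z
    · obtain ⟨r, hr, hrZ⟩ := Finset.exists_of_ssubset hZ
      refine ⟨r, hr, hrZ, fun d hd hdZ hdr => ?_⟩
      have h1 : r ∉ F X := fun h => hrZ (hFZ h)
      rw [if_neg h1, Finset.notMem_compl, Finset.mem_insert] at hdr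
      rcases hdr with rfl | hdr
      · rfl
      · exact absurd (hFZ (Finset.mem_of_mem_erase hdr)) hdZ
    · obtain ⟨r, hr, hrZ⟩ := Finset.not_subset.1 hFZ
      refine ⟨r, (hF X hX).1 hr, hrZ, fun d hd hdZ hdr => ?_⟩
      rw [if_pos hr, Finset.notMem_compl] at hdr
      simp only [if_pos hr, if_pos hdr]

end Types

namespace ColoredForest

/-- Two disjoint sets `A ∋ α` and `B ∋ β` of size `c + 1` fit into the palette exactly because `c +
2 ≤ Δ`. With `X₀ = Bᶜ`, `X₁ = Aᶜ`, `F X₀ = A` and `F X₁ = B`, the types alternate along `α, β, α,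
…`. -/
theorem exists_isTypeSystem {Δ c : ℕ} (hΔ : c + 2 ≤ Δ) :
    ∃ (child : Finset (Fin (Δ + c)) → Fin (Δ + c) → Finset (Fin (Δ + c)))
      (X₀ X₁ : Finset (Fin (Δ + c))) (α β : Fin (Δ + c)),
      IsTypeSystem Δ child ∧ IsAlternating X₀ X₁ α β ∧ X₀.card + 1 = Δ ∧ X₁.card + 1 = Δ ∧
        child X₀ α = X₁ ∧ child X₁ β = X₀ := by
  classical
  obtain ⟨A, -, hA⟩ := Finset.exists_subset_card_eq
    (s := (Finset.univ : Finset (Fin (Δ + c)))) (n := c + 1) (by simp; omega)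
  have hAc : Aᶜ.card + 1 = Δ := by rw [Finset.card_compl, hA, Fintype.card_fin]; omega
  obtain ⟨B, hBA, hB⟩ := Finset.exists_subset_card_eq (s := Aᶜ) (n := c + 1) (by omega)
  have hBc : Bᶜ.card + 1 = Δ := by rw [Finset.card_compl, hB, Fintype.card_fin]; omega
  have hAB : A ⊆ Bᶜ := Finset.subset_compl_comm.1 hBA
  have hne : Bᶜ ≠ Aᶜ := by
    intro h
    obtain rfl := compl_injective h
    obtain ⟨b, hb⟩ := Finset.card_pos.1 (show 0 < B.card by omega)
    exact Finset.mem_compl.1 (hBA hb) hb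
  obtain ⟨α, hα⟩ := Finset.card_pos.1 (show 0 < A.card by omega)
  obtain ⟨β, hβ⟩ := Finset.card_pos.1 (show 0 < B.card by omega)
  have hex : ∀ X : Finset (Fin (Δ + c)), X.card + 1 = Δ → ∃ G, (G ⊆ X ∧ G.card = c + 1) ∧
      (X = Bᶜ → G = A) ∧ (X = Aᶜ → G = B) := by
    intro X hX
    by_cases h0 : X = Bᶜ
    · subst h0
      exact ⟨A, ⟨hAB, hA⟩, fun _ => rfl, fun h => absurd h hne⟩
    · by_cases h1 : X = Aᶜ
      · subst h1
        exact ⟨B, ⟨hBA, hB⟩, fun h => absurd h h0, fun _ => rfl⟩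
      · obtain ⟨G, hG⟩ := Finset.exists_subset_card_eq (s := X) (n := c + 1) (by omega)
        exact ⟨G, hG, fun h => absurd h h0, fun h => absurd h h1⟩
  choose! F hF hF0 hF1 using hex
  have hex' : ∀ X : Finset (Fin (Δ + c)), X.card + 1 = Δ → ∃ a, a ∈ F X := by
    intro X hX
    exact Finset.card_pos.1 (by rw [(hF X hX).2]; omega)
  have : Nonempty (Fin (Δ + c)) := ⟨α⟩
  choose! f hf using hex'
  refine ⟨_, Bᶜ, Aᶜ, α, β, exists_isTypeSystem_of_core rfl F f hF hf,
    ⟨by rw [compl_compl]; exact hBA, hAB hα, by simpa using hα, hBA hβ, by simpa using hβ⟩,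
    hBc, hAc, ?_, ?_⟩
  · simp only [hF0 _ hBc rfl, if_pos hα]
  · simp only [hF1 _ hAc rfl, if_pos hβ]

/-! ### Trees as sets of words of colours. -/

section Words

variable {κ : ℕ} (child : Finset (Fin κ) → Fin κ → Finset (Fin κ))

/-- The vertices of the tree of depth `k` whose root has type `X`, as words of colours. -/
def Valid : ℕ → Finset (Fin κ) → List (Fin κ) → Prop
  | _, _, [] => True
  | 0, _, _ :: _ => False
  | k + 1, X, r :: w => r ∈ X ∧ Valid k (child X r) w

/-- The type of a vertex of the tree whose root has type `X`. -/
def typeAt (X : Finset (Fin κ)) (w : List (Fin κ)) : Finset (Fin κ) := w.foldl child X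

variable {child}

@[simp]
theorem valid_nil {k : ℕ} {X : Finset (Fin κ)} : Valid child k X [] := by
  cases k <;> trivial

theorem valid_append {r : Fin κ} : ∀ {w : List (Fin κ)} {k : ℕ} {X : Finset (Fin κ)},
    Valid child k X (w ++ [r]) ↔ Valid child k X w ∧ w.length < k ∧ r ∈ typeAt child X w
  | [], 0, X => by simp [Valid]
  | [], k + 1, X => by simp [Valid, typeAt]
  | a :: w, 0, X => by simp [Valid]
  | a :: w, k + 1, X => by
    simp only [List.cons_append, Valid, valid_append (w := w), List.length_cons, typeAt,
      List.foldl_cons, add_lt_add_iff_right]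
    tauto

theorem typeAt_append (X : Finset (Fin κ)) (w : List (Fin κ)) (r : Fin κ) :
    typeAt child X (w ++ [r]) = child (typeAt child X w) r := by
  simp [typeAt]

theorem card_typeAt {Δ : ℕ} (hchild : IsTypeSystem Δ child) :
    ∀ {w : List (Fin κ)} {k : ℕ} {X : Finset (Fin κ)}, X.card + 1 = Δ → Valid child k X w →
      (typeAt child X w).card + 1 = Δ
  | [], _, _, hX, _ => hX
  | _ :: _, 0, _, _, hw => hw.elim
  | _ :: w, _ + 1, _, hX, hw => card_typeAt hchild (w := w) (hchild.card _ _ hX hw.1) hw.2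

variable (α β : Fin κ)

/-- The word `α, β, α, …` of length `i`. -/
def altWord : ℕ → List (Fin κ)
  | 0 => []
  | i + 1 => altWord i ++ [altColor α β (i + 1)]

@[simp]
theorem length_altWord : ∀ i, (altWord α β i).length = i
  | 0 => rfl
  | i + 1 => by simp [altWord, length_altWord i]

theorem altWord_prefix {i j : ℕ} (h : i ≤ j) : altWord α β i <+: altWord α β j := by
  induction j, h using Nat.le_induction with
  | base => exact List.prefix_rfl
  | succ j _ ih => exact ih.trans (List.prefix_append _ _)

variable {α β}

theorem eq_altColor_of_prefix {i j : ℕ} {r : Fin κ} (h : altWord α β i ++ [r] <+: altWord α β j) :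
    r = altColor α β (i + 1) := by
  have hlen := h.length_le
  simp only [List.length_append, length_altWord, List.length_singleton] at hlen
  have h' := altWord_prefix α β hlen
  have := List.prefix_of_prefix_length_le h h' (by simp)
  have := this.eq_of_length (by simp)
  rw [altWord] at this
  simpa using this

variable {X₀ X₁ : Finset (Fin κ)}

theorem typeAt_altWord (h0 : child X₀ α = X₁) (h1 : child X₁ β = X₀) :
    ∀ i, typeAt child X₀ (altWord α β i) = altType X₀ X₁ i
  | 0 => by simp [altWord, typeAt, altType]
  | i + 1 => by
    rw [altWord, typeAt_append, typeAt_altWord h0 h1 i]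
    by_cases h : Even i <;> simp [altType, altColor, Nat.even_add_one, h, h0, h1]

theorem valid_altWord (hA : IsAlternating X₀ X₁ α β) (h0 : child X₀ α = X₁)
    (h1 : child X₁ β = X₀) {L : ℕ} : ∀ {i}, i ≤ L → Valid child L X₀ (altWord α β i)
  | 0, _ => by simp [altWord]
  | i + 1, hi => by
    rw [altWord, valid_append, length_altWord, typeAt_altWord h0 h1]
    exact ⟨valid_altWord hA h0 h1 (by omega), by omega, hA.mem i⟩

end Words

variable {n Δ κ : ℕ} {S T : ColoredForest n Δ κ}

/-- The words in `P` label the vertices of a component of `S`: the edge from `w` to `w ++ [r]` has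
the colour `r`, and there are no other edges. -/
structure Realizes (S : ColoredForest n Δ κ) (P : List (Fin κ) → Prop)
    (φ : List (Fin κ) → Fin n) : Prop where
  inj : ∀ w w', P w → P w' → φ w = φ w' → w = w'
  edge : ∀ w r, P (w ++ [r]) → S.color s(φ w, φ (w ++ [r])) = some r
  closed : ∀ w, P w → ∀ z d, S.color s(φ w, z) = some d →
    (P (w ++ [d]) ∧ z = φ (w ++ [d])) ∨ ∃ w', w = w' ++ [d] ∧ z = φ w'

/-- No edge leaves the set `U`. -/
def IsClosed (S : ColoredForest n Δ κ) (U : Finset (Fin n)) : Prop :=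
  ∀ a ∈ U, ∀ b d, S.color s(a, b) = some d → b ∈ U

theorem IsClosed.not_reachable {U : Finset (Fin n)} (h : S.IsClosed U) {a b : Fin n} (ha : a ∈ U)
    (hb : b ∉ U) : ¬ S.graph.Reachable a b := by
  rintro ⟨p⟩
  induction p with
  | nil => exact hb ha
  | cons hadj q ih =>
    obtain ⟨d, hd⟩ := S.adj_iff.1 hadj
    exact ih (h _ ha _ d hd) hb

theorem notMem_colorsAt_deleteEdge {u v : Fin n} {d : Fin κ} (h : S.color s(u, v) = some d) :
    d ∉ (S.deleteEdge u v).colorsAt u ∧ ((S.deleteEdge u v).colorsAt u).card < Δ := by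
  have key : d ∉ (S.deleteEdge u v).colorsAt u := by
    intro hm
    obtain ⟨w, hw⟩ := mem_colorsAt.1 hm
    rw [deleteEdge_color] at hw
    by_cases he : s(u, w) = s(u, v)
    · rw [he, Function.update_self] at hw; simp at hw
    · rw [Function.update_of_ne he] at hw
      exact he (by rw [eq_of_color_eq hw h])
  refine ⟨key, lt_of_lt_of_le (Finset.card_lt_card ?_) (S.card_colorsAt_le u)⟩
  rw [Finset.ssubset_iff_of_subset]
  · exact ⟨d, mem_colorsAt.2 ⟨v, h⟩, key⟩
  · intro a ha
    obtain ⟨w, hw⟩ := mem_colorsAt.1 ha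
    rw [deleteEdge_color] at hw
    by_cases he : s(u, w) = s(u, v)
    · rw [he, Function.update_self] at hw; simp at hw
    · rw [Function.update_of_ne he] at hw
      exact mem_colorsAt.2 ⟨w, hw⟩

theorem deleteEdge_comm (S : ColoredForest n Δ κ) (u v : Fin n) :
    S.deleteEdge u v = S.deleteEdge v u := by
  refine color_ext ?_
  simp only [deleteEdge_color]
  rw [Sym2.eq_swap]

theorem not_reachable_deleteEdge {u v : Fin n} (h : S.graph.Adj u v) :
    ¬ (S.deleteEdge u v).graph.Reachable u v := by
  have := (SimpleGraph.isAcyclic_iff_forall_adj_isBridge.1 S.isAcyclic) h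
  rw [SimpleGraph.isBridge_iff] at this
  exact this

theorem altColor_congr {α β : Fin κ} {i j : ℕ} (h : Even i ↔ Even j) :
    altColor α β i = altColor α β j := by simp [altColor, h]

theorem altType_congr {X₀ X₁ : Finset (Fin κ)} {i j : ℕ} (h : Even i ↔ Even j) :
    altType X₀ X₁ i = altType X₀ X₁ j := by simp [altType, h]

/-! ### Flipping the path back. -/

namespace ZigZag

variable {X₀ X₁ : Finset (Fin κ)} {α β : Fin κ} {D : ℕ} {x : ℕ → Fin n} {v : Fin n}
  (h : ZigZag S X₀ X₁ α β D x v)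
include h

theorem reachable : ∀ i ≤ D, S.graph.Reachable (x 0) (x i)
  | 0, _ => SimpleGraph.Reachable.refl _
  | i + 1, hi => (reachable i (by omega)).trans
      (SimpleGraph.Adj.reachable (S.adj_iff.2 ⟨_, h.path i hi⟩))

theorem right_notMem_colorsAt_flip_last : β ∉ h.flip.colorsAt (x D) := by
  intro hm
  obtain ⟨w, hw⟩ := mem_colorsAt.1 hm
  rw [flip_color, flipColor] at hw
  split_ifs at hw with h1
  · obtain ⟨a, ha, had⟩ := Option.map_eq_some_iff.1 hw
    have : a = α := (Equiv.swap α β).injective (had.trans (Equiv.swap_apply_left α β).symm)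
    subst this
    exact h.last (mem_colorsAt.2 ⟨w, ha⟩)
  · obtain ⟨k, rfl⟩ : ∃ k, D = k + 1 := ⟨D - 1, by have := h.pos; omega⟩
    have := h.path k (by omega)
    rw [altColor, if_pos h.even, Sym2.eq_swap] at this
    obtain rfl := eq_of_color_eq hw this
    exact h1 (mem_pathEdges.2 ⟨k, by omega, Sym2.eq_swap⟩)

/-- The flip moves the missing `β` from `x 0` to `x D` and the missing `α` from `x D` to `x 0`. As
`D` is even, `D - i` and `i` have the same parity, so the reversed path alternates with the same
types and colours. -/
theorem reverse (hlast : (S.colorsAt (x D)).card < Δ)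
    (off : ∀ i ≤ D, ∀ r ∈ altType X₀ X₁ i, r ≠ altColor α β (i + 1) → ∃ y,
      h.flip.color s(x i, y) = some r ∧ ∃ Y, (altType X₀ X₁ i)ᶜ ⊆ Y ∧ h.flip.Rigid D Y (x i) y)
    (rigid : h.flip.Rigid (D + 1) X₁ (x D) v) :
    ZigZag h.flip X₀ X₁ α β D (fun i => x (D - i)) v where
  pos := h.pos
  even := h.even
  alt := h.alt
  inj := fun i hi j hj hij => by
    have := h.inj _ (Nat.sub_le D i) _ (Nat.sub_le D j) hij
    omega
  path := fun i hi => by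
    have hp := h.path (D - (i + 1)) (by omega)
    have hsub : D - (i + 1) + 1 = D - i := by omega
    rw [flip_color, flipColor, if_pos (mem_pathEdges.2 ⟨D - (i + 1), by omega, by
      rw [hsub, Sym2.eq_swap]⟩), Sym2.eq_swap]
    simp only [hsub] at hp
    rw [hp, Option.map_some, ← hsub, swap_altColor]
    congr 1
    refine altColor_congr ?_
    rw [Nat.even_sub (by omega)]
    simp [h.even]
  off := fun i hi r hr hne => by
    have hpar : Even (D - i) ↔ Even i := by rw [Nat.even_sub hi]; simp [h.even]
    have hpar' : Even (D - i + 1) ↔ Even (i + 1) := by simp [Nat.even_add_one, hpar]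
    have := off (D - i) (Nat.sub_le _ _) r (by rwa [altType_congr hpar])
      (by rwa [altColor_congr hpar'])
    rwa [altType_congr hpar] at this
  rigid := rigid
  ne := fun i _ => h.ne _ (Nat.sub_le _ _)
  not_reachable := fun hr => h.not_reachable ((h.reachable D le_rfl).trans hr)
  card_left := h.card_colorsAt_flip _ ▸ hlast
  card_right := h.card_colorsAt_flip _ ▸ h.card_right
  left := h.right_notMem_colorsAt_flip_last
  right := h.right_notMem_colorsAt_flip
  last := by simpa using h.left_notMem_colorsAt_flip

omit h in
theorem pathEdges_reverse (x : ℕ → Fin n) (D : ℕ) :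
    pathEdges (fun i => x (D - i)) D = pathEdges x D := by
  ext e
  simp only [mem_pathEdges]
  constructor
  · rintro ⟨i, hi, rfl⟩
    refine ⟨D - (i + 1), by omega, ?_⟩
    rw [Sym2.eq_swap, show D - (i + 1) + 1 = D - i by omega]
  · rintro ⟨i, hi, rfl⟩
    refine ⟨D - (i + 1), by omega, ?_⟩
    rw [Sym2.eq_swap, show D - (D - (i + 1) + 1) = i by omega,
      show D - (D - (i + 1)) = i + 1 by omega]

omit h in
theorem flip_flip (h : ZigZag S X₀ X₁ α β D x v)
    (h' : ZigZag h.flip X₀ X₁ α β D (fun i => x (D - i)) v) : h'.flip = S := by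
  refine color_ext (funext fun e => ?_)
  rw [flip_color, flipColor, flip_color, flipColor, pathEdges_reverse]
  split_ifs
  · have : (Equiv.swap α β : Fin κ → Fin κ) ∘ Equiv.swap α β = id := by ext a; simp
    rw [Option.map_map, this, Option.map_id, id]
  · rfl

end ZigZag

/-! ### The cut tree is a bad state. -/

section Bad

variable {child : Finset (Fin κ) → Fin κ → Finset (Fin κ)} {X₀ X₁ : Finset (Fin κ)} {α β : Fin κ}
  {φ : List (Fin κ) → Fin n} {L D : ℕ}

theorem Realizes.edge_injective (hφ : T.Realizes (Valid child L X₀) φ) {w w' : List (Fin κ)}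
    {r r' : Fin κ} (hw : Valid child L X₀ (w ++ [r])) (hw' : Valid child L X₀ (w' ++ [r']))
    (he : s(φ w, φ (w ++ [r])) = s(φ w', φ (w' ++ [r']))) : w = w' ∧ r = r' := by
  rw [Sym2.eq_iff] at he
  rcases he with ⟨h1, h2⟩ | ⟨h1, h2⟩
  · obtain rfl := hφ.inj _ _ (valid_append.1 hw).1 (valid_append.1 hw').1 h1
    have := hφ.inj _ _ hw hw' h2
    exact ⟨rfl, by simpa using this⟩
  · have h3 := congrArg List.length (hφ.inj _ _ (valid_append.1 hw).1 hw' h1)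
    have h4 := congrArg List.length (hφ.inj _ _ hw (valid_append.1 hw').1 h2)
    simp at h3 h4
    omega

/-- The labelling belongs to the intact tree `T`, but only the colours of `S` below `w` matter. So
this applies to the cut tree and to its flipped version alike. -/
theorem rigid_of_subtree (hchild : IsTypeSystem Δ child) (hX₀ : X₀.card + 1 = Δ)
    (hφ : T.Realizes (Valid child L X₀) φ) :
    ∀ {k : ℕ} {w : List (Fin κ)} {p : Fin n}, Valid child L X₀ w → k + w.length ≤ L →
      (∀ r, Valid child L X₀ (w ++ [r]) → φ (w ++ [r]) ≠ p) →
      (∀ w' r, w <+: w' → Valid child L X₀ (w' ++ [r]) →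
        S.color s(φ w', φ (w' ++ [r])) = some r) →
      S.Rigid k (typeAt child X₀ w) p (φ w)
  | 0, _, _, _, _, _, _ => trivial
  | k + 1, w, p, hw, hk, hp, hS => by
    intro r hr
    have hwr : Valid child L X₀ (w ++ [r]) := valid_append.2 ⟨hw, by omega, hr⟩
    refine ⟨φ (w ++ [r]), hp r hwr, hS w r List.prefix_rfl hwr, typeAt child X₀ (w ++ [r]), ?_, ?_⟩
    · rw [typeAt_append]
      exact hchild.compl _ _ (card_typeAt hchild hX₀ hw) hr
    · refine rigid_of_subtree hchild hX₀ hφ hwr (by simp; omega) (fun r' hr' he => ?_)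
        (fun w' r' hpre => hS w' r' ((List.prefix_append _ _).trans hpre))
      have := congrArg List.length (hφ.inj _ _ hr' hw he)
      simp at this

variable (hchild : IsTypeSystem Δ child) (hA : IsAlternating X₀ X₁ α β) (hX₀ : X₀.card + 1 = Δ)
  (h0 : child X₀ α = X₁) (h1 : child X₁ β = X₀) (hφ : T.Realizes (Valid child L X₀) φ)
  (hL : L = 2 * D + 2)
include hchild hA hX₀ h0 h1 hφ hL

/-- A child off the path has depth at most `D + 1`, so at least `D` levels of the tree lie below it.
The hypothesis `hS` holds before and after the flip. -/
theorem exists_rigid_off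
    (hS : ∀ w r, Valid child L X₀ (w ++ [r]) → (∀ j ≤ D, w = altWord α β j →
      r ≠ altColor α β (j + 1)) → S.color s(φ w, φ (w ++ [r])) = some r)
    (i : ℕ) (hi : i ≤ D) (r : Fin κ) (hr : r ∈ altType X₀ X₁ i) (hne : r ≠ altColor α β (i + 1)) :
    ∃ y, S.color s(φ (altWord α β i), y) = some r ∧
      ∃ Y, (altType X₀ X₁ i)ᶜ ⊆ Y ∧ S.Rigid D Y (φ (altWord α β i)) y := by
  have hw : Valid child L X₀ (altWord α β i) := valid_altWord hA h0 h1 (by omega)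
  have hty : typeAt child X₀ (altWord α β i) = altType X₀ X₁ i := typeAt_altWord h0 h1 i
  have hwr : Valid child L X₀ (altWord α β i ++ [r]) :=
    valid_append.2 ⟨hw, by simp; omega, hty ▸ hr⟩
  refine ⟨φ (altWord α β i ++ [r]), hS _ _ hwr ?_, typeAt child X₀ (altWord α β i ++ [r]), ?_, ?_⟩
  · intro j _ hij
    have := congrArg List.length hij
    simp only [length_altWord] at this
    exact this ▸ hne
  · rw [typeAt_append, hty]
    exact hchild.compl _ _ (hty ▸ card_typeAt hchild hX₀ hw) hr
  · refine rigid_of_subtree hchild hX₀ hφ hwr (by simp; omega) (fun r' hr' he => ?_)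
      (fun w' r' hpre hv => hS w' r' hv ?_)
    · have := congrArg List.length (hφ.inj _ _ hr' hw he)
      simp at this
    · rintro j - rfl
      exact absurd (eq_altColor_of_prefix hpre) hne

/-- The vertex `v` has depth `D + 1` and needs `D + 1` levels below it; this is what fixes the depth
`L = 2 * D + 2`. -/
theorem rigid_right
    (hS : ∀ w r, Valid child L X₀ (w ++ [r]) → (∀ j ≤ D, w = altWord α β j →
      r ≠ altColor α β (j + 1)) → S.color s(φ w, φ (w ++ [r])) = some r)
    (hD : Even D) {i : ℕ} (hi : i ≤ D) :
    S.Rigid (D + 1) X₁ (φ (altWord α β i)) (φ (altWord α β (D + 1))) := by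
  have hw : Valid child L X₀ (altWord α β (D + 1)) := valid_altWord hA h0 h1 (by omega)
  have hty : typeAt child X₀ (altWord α β (D + 1)) = X₁ := by
    rw [typeAt_altWord h0 h1]
    simp [altType, Nat.even_add_one, hD]
  rw [← hty]
  refine rigid_of_subtree hchild hX₀ hφ hw (by simp; omega) (fun r' hr' he => ?_)
    (fun w' r' hpre hv => hS w' r' hv ?_)
  · have := congrArg List.length (hφ.inj _ _ hr'
      (valid_altWord hA h0 h1 (show i ≤ L by omega)) he)
    simp at this
    omega
  · rintro j hj rfl
    have := hpre.length_le
    simp at this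
    omega

omit hchild hX₀ in
theorem edge_altWord {i : ℕ} (hi : i ≤ D) :
    T.color s(φ (altWord α β i), φ (altWord α β (i + 1))) = some (altColor α β (i + 1)) :=
  hφ.edge _ _ (valid_altWord hA h0 h1 (show i + 1 ≤ L by omega))

omit hchild hX₀ in
theorem edge_altWord_injective {i j : ℕ} (hi : i ≤ D) (hj : j ≤ D)
    (he : s(φ (altWord α β i), φ (altWord α β (i + 1))) =
      s(φ (altWord α β j), φ (altWord α β (j + 1)))) : i = j := by
  have := (hφ.edge_injective (valid_altWord hA h0 h1 (show i + 1 ≤ L by omega))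
    (valid_altWord hA h0 h1 (show j + 1 ≤ L by omega)) he).1
  simpa using congrArg List.length this

omit hchild hX₀ in
/-- The edges off the alternating path keep their colours when the edge at its end is deleted. -/
theorem deleteEdge_off (w : List (Fin κ)) (r : Fin κ) (hw : Valid child L X₀ (w ++ [r]))
    (hne : ∀ j ≤ D, w = altWord α β j → r ≠ altColor α β (j + 1)) :
    (T.deleteEdge (φ (altWord α β D)) (φ (altWord α β (D + 1)))).color
      s(φ w, φ (w ++ [r])) = some r := by
  rw [deleteEdge_color, Function.update_of_ne]
  · exact hφ.edge w r hw
  · intro he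
    obtain ⟨rfl, rfl⟩ := hφ.edge_injective hw
      (valid_altWord hA h0 h1 (show D + 1 ≤ L by omega)) he
    exact hne D le_rfl rfl rfl

/-- The deleted edge has colour `α`, which becomes free at both of its ends; `β` is free at the
root, which has no parent edge and has type `X₀`. -/
theorem zigZag_deleteEdge (hpos : 0 < D) (hD : Even D) :
    ZigZag (T.deleteEdge (φ (altWord α β D)) (φ (altWord α β (D + 1)))) X₀ X₁ α β D
      (fun i => φ (altWord α β i)) (φ (altWord α β (D + 1))) := by
  have hlast := edge_altWord hA h0 h1 hφ hL (le_refl D)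
  have hα : altColor α β (D + 1) = α := by simp [altColor, Nat.even_add_one, hD]
  rw [hα] at hlast
  have hpath : ∀ i < D, (T.deleteEdge (φ (altWord α β D)) (φ (altWord α β (D + 1)))).color
      s(φ (altWord α β i), φ (altWord α β (i + 1))) = some (altColor α β (i + 1)) := by
    intro i hi
    rw [deleteEdge_color, Function.update_of_ne, edge_altWord hA h0 h1 hφ hL hi.le]
    intro he
    have := edge_altWord_injective hA h0 h1 hφ hL hi.le le_rfl he
    omega
  have hroot : (T.deleteEdge (φ (altWord α β D)) (φ (altWord α β (D + 1)))).colorsAt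
      (φ (altWord α β 0)) ⊆ X₀ := by
    intro d hd
    obtain ⟨z, hz⟩ := mem_colorsAt.1 hd
    rw [deleteEdge_color] at hz
    have hz' : T.color s(φ [], z) = some d := by
      by_cases he : s(φ (altWord α β 0), z) = s(φ (altWord α β D), φ (altWord α β (D + 1)))
      · rw [he, Function.update_self] at hz; simp at hz
      · rwa [Function.update_of_ne he] at hz
    rcases hφ.closed [] valid_nil z d hz' with ⟨hv, -⟩ | ⟨w', hw', -⟩
    · exact (valid_append.1 hv).2.2
    · simp at hw'
  have hreach : ∀ i ≤ D, (T.deleteEdge (φ (altWord α β D))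
      (φ (altWord α β (D + 1)))).graph.Reachable (φ (altWord α β 0)) (φ (altWord α β i)) := by
    intro i
    induction i with
    | zero => intro _; exact SimpleGraph.Reachable.refl _
    | succ i ih =>
      intro hi
      exact (ih (by omega)).trans (SimpleGraph.Adj.reachable ((adj_iff _).2 ⟨_, hpath i hi⟩))
  refine ⟨hpos, hD, hA, ?_, hpath, ?_, ?_, ?_, ?_, ?_, ?_, ?_, ?_, ?_⟩
  · intro i hi j hj hij
    simpa using congrArg List.length (hφ.inj _ _ (valid_altWord hA h0 h1 (show i ≤ L by omega))
      (valid_altWord hA h0 h1 (show j ≤ L by omega)) hij)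
  · exact exists_rigid_off hchild hA hX₀ h0 h1 hφ hL
      (deleteEdge_off hA h0 h1 hφ hL)
  · exact rigid_right hchild hA hX₀ h0 h1 hφ hL (deleteEdge_off hA h0 h1 hφ hL) hD
      (Nat.zero_le _)
  · intro i hi he
    have := congrArg List.length (hφ.inj _ _ (valid_altWord hA h0 h1 (show i ≤ L by omega))
      (valid_altWord hA h0 h1 (show D + 1 ≤ L by omega)) he)
    simp at this
    omega
  · intro hr
    exact not_reachable_deleteEdge (T.adj_iff.2 ⟨_, hlast⟩) ((hreach D le_rfl).symm.trans hr)
  · have := Finset.card_le_card hroot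
    omega
  · rw [deleteEdge_comm]
    exact (notMem_colorsAt_deleteEdge (Sym2.eq_swap ▸ hlast)).2
  · exact fun hm => hA.right_notMem (hroot hm)
  · rw [deleteEdge_comm]
    exact (notMem_colorsAt_deleteEdge (Sym2.eq_swap ▸ hlast)).1
  · exact (notMem_colorsAt_deleteEdge hlast).1

/-- The cycle inserts and deletes an edge from `v` to `x 0`, then one from `v` to `x D`, then one
between the isolated vertices `z` and `z'`. Each of the first two pairs costs at least `D`. -/
theorem isBadState_deleteEdge (hpos : 0 < D) (hD : Even D) {z z' : Fin n} (hz : T.colorsAt z = ∅)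
    (hz' : T.colorsAt z' = ∅) (hzz : z ≠ z') {B : ℝ} (hB : 6 * B ≤ 2 * D) :
    IsBadState (T.deleteEdge (φ (altWord α β D)) (φ (altWord α β (D + 1)))) B := by
  have hlast := edge_altWord hA h0 h1 hφ hL (le_refl D)
  have h := zigZag_deleteEdge hchild hA hX₀ h0 h1 hφ hL hpos hD
  have hS : ∀ w r, Valid child L X₀ (w ++ [r]) → (∀ j ≤ D, w = altWord α β j →
      r ≠ altColor α β (j + 1)) → h.flip.color s(φ w, φ (w ++ [r])) = some r := by
    intro w r hw hne
    rw [ZigZag.flip_color, flipColor, if_neg, deleteEdge_off hA h0 h1 hφ hL w r hw hne]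
    rw [mem_pathEdges]
    rintro ⟨i, hi, he⟩
    obtain ⟨h2, h3⟩ := hφ.edge_injective (valid_altWord hA h0 h1 (show i + 1 ≤ L by omega)) hw he
    exact hne i hi.le h2.symm h3.symm
  have h' := h.reverse (notMem_colorsAt_deleteEdge hlast).2
    (exists_rigid_off hchild hA hX₀ h0 h1 hφ hL hS)
    (rigid_right hchild hA hX₀ h0 h1 hφ hL hS hD le_rfl)
  have hiso : ∀ y, T.colorsAt y = ∅ → (T.deleteEdge (φ (altWord α β D))
      (φ (altWord α β (D + 1)))).colorsAt y = ∅ := by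
    intro y hy
    rw [Finset.eq_empty_iff_forall_notMem] at hy ⊢
    intro d hd
    obtain ⟨w, hw⟩ := mem_colorsAt.1 hd
    rw [deleteEdge_color] at hw
    by_cases he : s(y, w) = s(φ (altWord α β D), φ (altWord α β (D + 1)))
    · rw [he, Function.update_self] at hw; simp at hw
    · rw [Function.update_of_ne he] at hw
      exact hy d (mem_colorsAt.2 ⟨w, hw⟩)
  have hcan : (T.deleteEdge (φ (altWord α β D)) (φ (altWord α β (D + 1)))).CanAdd z z' α := by
    refine ⟨?_, by rw [hiso z hz]; simp; omega, by rw [hiso z' hz']; simp; omega,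
      by simp [hiso z hz], by simp [hiso z' hz']⟩
    refine IsClosed.not_reachable (U := {z}) ?_ (by simp) (by simpa using hzz.symm)
    intro a ha b d hd
    rw [Finset.mem_singleton] at ha
    subst ha
    have := hiso a hz
    rw [Finset.eq_empty_iff_forall_notMem] at this
    exact absurd (mem_colorsAt.2 ⟨b, hd⟩) (this d)
  have hf := (h.forced.append (h.flip_flip h' ▸ h'.forced)).append (forced_insert_delete hcan)
  refine hf.isBadState (by simp) ?_
  push_cast
  linarith

end Bad

end ColoredForest

/-! ### Building the tree in a game with an opponent who chooses colours. -/

namespace ColoredForest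

variable {n Δ κ : ℕ} {S T T' : ColoredForest n Δ κ}

/-- The edges with an end outside `U` are the same, with the same colours, in `S` and `T`. -/
def AgreeOff (U : Finset (Fin n)) (S T : ColoredForest n Δ κ) : Prop :=
  ∀ a ∉ U, ∀ b, T.color s(a, b) = S.color s(a, b)

namespace AgreeOff

variable {U V : Finset (Fin n)}

theorem refl (U : Finset (Fin n)) (S : ColoredForest n Δ κ) : AgreeOff U S S := fun _ _ _ => rfl

theorem trans (h : AgreeOff U S T) (h' : AgreeOff U T T') : AgreeOff U S T' :=
  fun a ha b => (h' a ha b).trans (h a ha b)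

theorem mono (h : AgreeOff U S T) (hUV : U ⊆ V) : AgreeOff V S T :=
  fun a ha b => h a (fun h' => ha (hUV h')) b

theorem isClosed_self (h : AgreeOff U S T) (hU : S.IsClosed U) : T.IsClosed U := by
  intro a ha b d hd
  by_contra hb
  have := h b hb a
  rw [Sym2.eq_swap, hd] at this
  exact hb (hU a ha b d (Sym2.eq_swap ▸ this.symm))

theorem isClosed (h : AgreeOff U S T) (hUV : Disjoint U V) (hV : S.IsClosed V) :
    T.IsClosed V := by
  intro a ha b d hd
  rw [h a (Finset.disjoint_right.1 hUV ha)] at hd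
  exact hV a ha b d hd

theorem colorsAt_eq (h : AgreeOff U S T) {a : Fin n} (ha : a ∉ U) :
    T.colorsAt a = S.colorsAt a := by
  ext d
  simp only [mem_colorsAt, h a ha]

theorem realizes (h : AgreeOff U S T) {P : List (Fin κ) → Prop} {φ : List (Fin κ) → Fin n}
    (hφ : S.Realizes P φ) (hU : ∀ w, P w → φ w ∉ U) : T.Realizes P φ where
  inj := hφ.inj
  edge := fun w r hw => by
    rw [Sym2.eq_swap, h _ (hU _ hw), Sym2.eq_swap, hφ.edge w r hw]
  closed := fun w hw z d hd => hφ.closed w hw z d (by rwa [h _ (hU _ hw)] at hd)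

end AgreeOff

theorem agreeOff_addEdge {u v : Fin n} {d : Fin κ} (h : S.CanAdd u v d) {U : Finset (Fin n)}
    (hu : u ∈ U) (hv : v ∈ U) : AgreeOff U S (S.addEdge u v d h) := by
  intro a ha b
  rw [addEdge_color, Function.update_of_ne]
  intro he
  rw [Sym2.eq_iff] at he
  rcases he with ⟨rfl, -⟩ | ⟨rfl, -⟩
  · exact ha hu
  · exact ha hv

theorem IsClosed.union {U V : Finset (Fin n)} (hU : S.IsClosed U) (hV : S.IsClosed V) :
    S.IsClosed (U ∪ V) := by
  intro a ha b d hd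
  rcases Finset.mem_union.1 ha with ha | ha
  · exact Finset.mem_union_left _ (hU a ha b d hd)
  · exact Finset.mem_union_right _ (hV a ha b d hd)

theorem colorsAt_addEdge {u v : Fin n} {d : Fin κ} (h : S.CanAdd u v d) :
    (S.addEdge u v d h).colorsAt u = insert d (S.colorsAt u) ∧
      (S.addEdge u v d h).colorsAt v = insert d (S.colorsAt v) := by
  have hnone : S.color s(u, v) = none :=
    S.color_eq_none_iff.2 fun h' => h.not_reachable h'.reachable
  have key : ∀ a b : Fin n, s(a, b) = s(u, v) →
      (S.addEdge u v d h).colorsAt a = insert d (S.colorsAt a) := by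
    intro a b hab
    ext r
    simp only [mem_colorsAt, Finset.mem_insert, addEdge_color]
    constructor
    · rintro ⟨w, hw⟩
      by_cases he : s(a, w) = s(u, v)
      · rw [he, Function.update_self] at hw
        exact .inl (Option.some_injective _ hw).symm
      · rw [Function.update_of_ne he] at hw
        exact .inr ⟨w, hw⟩
    · rintro (rfl | ⟨w, hw⟩)
      · exact ⟨b, by rw [hab, Function.update_self]⟩
      · refine ⟨w, ?_⟩
        rw [Function.update_of_ne, hw]
        intro he
        rw [he, hnone] at hw
        simp at hw
  exact ⟨key u v rfl, key v u Sym2.eq_swap⟩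

theorem Realizes.congr {P P' : List (Fin κ) → Prop} {φ : List (Fin κ) → Fin n}
    (hφ : S.Realizes P φ) (h : ∀ w, P' w ↔ P w) : S.Realizes P' φ := by
  obtain rfl : P' = P := funext fun w => propext (h w)
  exact hφ

/-- The words of a tree whose root has the child edges with colours in `Z`, where `Q r` are the
words of the subtree of the child along the edge of colour `r`. -/
def Branch (Z : Finset (Fin κ)) (Q : Fin κ → List (Fin κ) → Prop) : List (Fin κ) → Prop
  | [] => True
  | r :: w => r ∈ Z ∧ Q r w

@[simp]
theorem branch_nil {Z : Finset (Fin κ)} {Q : Fin κ → List (Fin κ) → Prop} : Branch Z Q [] := trivial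

/-- The labelling of a tree that is obtained by attaching the tree with labelling `φ₂` to the root of
the tree with labelling `φ₁` by an edge of colour `d`. -/
def graft (φ₁ : List (Fin κ) → Fin n) (d : Fin κ) (φ₂ : List (Fin κ) → Fin n) :
    List (Fin κ) → Fin n
  | [] => φ₁ []
  | r :: w => if r = d then φ₂ w else φ₁ (r :: w)

theorem graft_eq {φ₁ φ₂ : List (Fin κ) → Fin n} {d : Fin κ} {Z : Finset (Fin κ)}
    {Q : Fin κ → List (Fin κ) → Prop} (hd : d ∉ Z) {w : List (Fin κ)} (hw : Branch Z Q w) :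
    graft φ₁ d φ₂ w = φ₁ w := by
  cases w with
  | nil => rfl
  | cons a w =>
    have : a ≠ d := fun h => hd (h ▸ hw.1)
    simp [graft, this]

theorem branch_insert {d : Fin κ} {Z : Finset (Fin κ)} {Q : Fin κ → List (Fin κ) → Prop}
    {w : List (Fin κ)} : Branch (insert d Z) Q w ↔ Branch Z Q w ∨ ∃ w', w = d :: w' ∧ Q d w' := by
  cases w with
  | nil => simp
  | cons a w =>
    simp only [Branch, Finset.mem_insert, List.cons.injEq]
    constructor
    · rintro ⟨rfl | h, h'⟩
      · exact .inr ⟨w, ⟨rfl, rfl⟩, h'⟩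
      · exact .inl ⟨h, h'⟩
    · rintro (⟨h, h'⟩ | ⟨w', ⟨rfl, rfl⟩, h'⟩)
      · exact ⟨.inr h, h'⟩
      · exact ⟨.inl rfl, h'⟩

theorem Realizes.realizes_graft {Z : Finset (Fin κ)} {Q : Fin κ → List (Fin κ) → Prop}
    {φ₁ φ₂ : List (Fin κ) → Fin n} {d : Fin κ} (h₁ : S.Realizes (Branch Z Q) φ₁)
    (h₂ : S.Realizes (Q d) φ₂) (hdisj : ∀ w w', Branch Z Q w → Q d w' → φ₁ w ≠ φ₂ w')
    (hnil : Q d []) (hd : d ∉ Z) (hadd : S.CanAdd (φ₁ []) (φ₂ []) d) :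
    (S.addEdge _ _ d hadd).Realizes (Branch (insert d Z) Q) (graft φ₁ d φ₂) := by
  have hcons : ∀ w, graft φ₁ d φ₂ (d :: w) = φ₂ w := fun w => by simp [ColoredForest.graft]
  have hroot : graft φ₁ d φ₂ [] = φ₁ [] := rfl
  have hgraft : ∀ (w : List (Fin κ)), (∀ a w', w = a :: w' → a ∈ Z) →
      graft φ₁ d φ₂ w = φ₁ w := by
    intro w hw
    cases w with
    | nil => rfl
    | cons a w =>
      have : a ≠ d := fun h => hd (h ▸ hw a w rfl)
      simp [ColoredForest.graft, this]
  refine ⟨?_, ?_, ?_⟩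
  · intro w w' hw hw' he
    rw [branch_insert] at hw hw'
    rcases hw with hw | ⟨u, rfl, hu⟩ <;> rcases hw' with hw' | ⟨u', rfl, hu'⟩
    · rw [graft_eq hd hw, graft_eq hd hw'] at he
      exact h₁.inj _ _ hw hw' he
    · rw [graft_eq hd hw, hcons] at he
      exact absurd he (hdisj _ _ hw hu')
    · rw [graft_eq hd hw', hcons] at he
      exact absurd he.symm (hdisj _ _ hw' hu)
    · rw [hcons, hcons] at he
      rw [h₂.inj _ _ hu hu' he]
  · intro w r hw
    rw [branch_insert] at hw
    rw [addEdge_color]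
    rcases hw with hw | ⟨u, hu, hQ⟩
    · have hwg : graft φ₁ d φ₂ w = φ₁ w := by
        refine hgraft w fun a w' haw => ?_
        subst haw
        exact hw.1
      rw [graft_eq hd hw, hwg, Function.update_of_ne, h₁.edge w r hw]
      intro he
      rw [Sym2.eq_iff] at he
      rcases he with ⟨-, h⟩ | ⟨-, h⟩
      · exact hdisj _ _ hw hnil h
      · have := h₁.inj _ _ hw branch_nil h
        simp at this
    · rw [hu, hcons]
      cases w with
      | nil =>
        simp only [List.nil_append, List.cons.injEq] at hu
        obtain ⟨rfl, rfl⟩ := hu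
        rw [hroot, Function.update_self]
      | cons a w =>
        simp only [List.cons_append, List.cons.injEq] at hu
        obtain ⟨rfl, rfl⟩ := hu
        rw [hcons, Function.update_of_ne, h₂.edge w r hQ]
        intro he
        rw [Sym2.eq_iff] at he
        rcases he with ⟨-, h⟩ | ⟨-, h⟩
        · have := h₂.inj _ _ hQ hnil h
          simp at this
        · exact hdisj _ _ branch_nil hQ h.symm
  · intro w hw z r hz
    rw [addEdge_color] at hz
    rw [branch_insert] at hw
    rcases hw with hw | ⟨u, rfl, hu⟩
    · rw [graft_eq hd hw] at hz
      by_cases he : s(φ₁ w, z) = s(φ₁ [], φ₂ [])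
      · rw [he, Function.update_self] at hz
        obtain rfl := Option.some_injective _ hz
        rw [Sym2.eq_iff] at he
        rcases he with ⟨h, rfl⟩ | ⟨h, -⟩
        · obtain rfl := h₁.inj _ _ hw branch_nil h
          exact .inl ⟨branch_insert.2 (.inr ⟨[], rfl, hnil⟩), (hcons []).symm⟩
        · exact absurd h (hdisj _ _ hw hnil)
      · rw [Function.update_of_ne he] at hz
        rcases h₁.closed w hw z r hz with ⟨hb, rfl⟩ | ⟨w', rfl, rfl⟩
        · exact .inl ⟨branch_insert.2 (.inl hb), (graft_eq hd hb).symm⟩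
        · refine .inr ⟨w', rfl, (hgraft w' fun a w'' haw => ?_).symm⟩
          subst haw
          exact hw.1
    · rw [hcons] at hz
      by_cases he : s(φ₂ u, z) = s(φ₁ [], φ₂ [])
      · rw [he, Function.update_self] at hz
        obtain rfl := Option.some_injective _ hz
        rw [Sym2.eq_iff] at he
        rcases he with ⟨h, -⟩ | ⟨h, rfl⟩
        · exact absurd h.symm (hdisj _ _ branch_nil hu)
        · obtain rfl := h₂.inj _ _ hu hnil h
          exact .inr ⟨[], rfl, rfl⟩
      · rw [Function.update_of_ne he] at hz
        rcases h₂.closed u hu z r hz with ⟨hb, rfl⟩ | ⟨w', rfl, rfl⟩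
        · exact .inl ⟨branch_insert.2 (.inr ⟨u ++ [r], rfl, hb⟩), (hcons _).symm⟩
        · exact .inr ⟨d :: w', rfl, (hcons _).symm⟩

theorem Realizes.colorsAt_root {Z : Finset (Fin κ)} {Q : Fin κ → List (Fin κ) → Prop}
    {φ : List (Fin κ) → Fin n} (h : S.Realizes (Branch Z Q) φ) (hQ : ∀ r ∈ Z, Q r []) :
    S.colorsAt (φ []) = Z := by
  ext r
  rw [mem_colorsAt]
  constructor
  · rintro ⟨z, hz⟩
    rcases h.closed [] branch_nil z r hz with ⟨hb, -⟩ | ⟨w', hw', -⟩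
    · exact hb.1
    · simp at hw'
  · intro hr
    exact ⟨_, h.edge [] r ⟨hr, hQ r hr⟩⟩

theorem valid_succ {child : Finset (Fin κ) → Fin κ → Finset (Fin κ)} {k : ℕ}
    {X : Finset (Fin κ)} {w : List (Fin κ)} :
    Valid child (k + 1) X w ↔ Branch X (fun r => Valid child k (child X r)) w := by
  cases w <;> simp [Valid, Branch]

theorem valid_zero {child : Finset (Fin κ) → Fin κ → Finset (Fin κ)} {X : Finset (Fin κ)}
    {w : List (Fin κ)} : Valid child 0 X w ↔ w = [] := by
  cases w <;> simp [Valid]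

/-- `M P S` says that a state with the property `P` can be reached from `S` in some game in which
edges that need no recolouring can be inserted, but the colour is chosen by an opponent. -/
structure IsGame (M : (ColoredForest n Δ κ → Prop) → ColoredForest n Δ κ → Prop) : Prop where
  pure : ∀ {P S}, P S → M P S
  bind : ∀ {P Q S}, M P S → (∀ T, P T → M Q T) → M Q S
  insert : ∀ {P S u v d}, S.CanAdd u v d → (∀ d' (h : S.CanAdd u v d'), P (S.addEdge u v d' h)) →
    M P S

theorem IsGame.mono {M : (ColoredForest n Δ κ → Prop) → ColoredForest n Δ κ → Prop}
    (hM : IsGame M) {P Q : ColoredForest n Δ κ → Prop} (h : M P S) (hPQ : ∀ T, P T → Q T) :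
    M Q S := hM.bind h fun T hT => hM.pure (hPQ T hT)

/-- `St S m U` says that `m` stars with prescribed colours can be obtained within `U`. -/
structure IsStock (M : (ColoredForest n Δ κ → Prop) → ColoredForest n Δ κ → Prop)
    (St : ColoredForest n Δ κ → ℕ → Finset (Fin n) → Prop) : Prop where
  mono : ∀ {S m m' U}, St S m U → m' ≤ m → St S m' U
  split : ∀ {S a b U}, St S (a + b) U →
    ∃ U₁ U₂, U₁ ⊆ U ∧ U₂ ⊆ U ∧ Disjoint U₁ U₂ ∧ St S a U₁ ∧ St S b U₂
  agree : ∀ {S T m U V}, St S m U → AgreeOff V S T → Disjoint V U → St T m U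
  closed : ∀ {S m U}, St S m U → S.IsClosed U
  star : ∀ {S U} {Z : Finset (Fin κ)}, St S 1 U → Z.card ≤ Δ → M (fun T => AgreeOff U S T ∧
    ∃ φ, (∀ w, Branch Z (fun _ w => w = []) w → φ w ∈ U) ∧
      T.Realizes (Branch Z (fun _ w => w = [])) φ) S

section Build

variable {M : (ColoredForest n Δ κ → Prop) → ColoredForest n Δ κ → Prop}
  {St : ColoredForest n Δ κ → ℕ → Finset (Fin n) → Prop}
  {child : Finset (Fin κ) → Fin κ → Finset (Fin κ)}
  (hM : IsGame M) (hSt : IsStock M St) (hchild : IsTypeSystem Δ child)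
include hM hSt hchild

/-- `Z` is the set of colours already present at the root, and `j` counts the missing ones. A tree
of type `child X r`, with `r` from `exists_next`, is prepared and its root is joined to the main
root. The opponent's colour `d` avoids `Z` and `child X r`, hence lies in `X`. -/
theorem build_loop {k m : ℕ} {X : Finset (Fin κ)} (hX : X.card + 1 = Δ)
    (ih : ∀ {X : Finset (Fin κ)} {S : ColoredForest n Δ κ} {U : Finset (Fin n)}, X.card + 1 = Δ →
      St S m U → M (fun T => AgreeOff U S T ∧ ∃ φ, (∀ w, Valid child (k + 1) X w → φ w ∈ U) ∧
        T.Realizes (Valid child (k + 1) X) φ) S) :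
    ∀ (j : ℕ) {S : ColoredForest n Δ κ} {Z : Finset (Fin κ)} {U₁ U₂ : Finset (Fin n)}
      {φ₁ : List (Fin κ) → Fin n}, Z ⊆ X → (X \ Z).card = j → Disjoint U₁ U₂ → S.IsClosed U₁ →
      St S (j * m) U₂ → S.Realizes (Branch Z (fun r => Valid child (k + 1) (child X r))) φ₁ →
      (∀ w, Branch Z (fun r => Valid child (k + 1) (child X r)) w → φ₁ w ∈ U₁) →
      M (fun T => AgreeOff (U₁ ∪ U₂) S T ∧ ∃ φ, (∀ w, Valid child (k + 2) X w → φ w ∈ U₁ ∪ U₂) ∧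
        T.Realizes (Valid child (k + 2) X) φ) S
  | 0, S, Z, U₁, U₂, φ₁, hZ, hj, _, _, _, hφ, hU => by
    obtain rfl : Z = X :=
      Finset.Subset.antisymm hZ (Finset.sdiff_eq_empty_iff_subset.1 (Finset.card_eq_zero.1 hj))
    exact hM.pure ⟨.refl _ _, φ₁, fun w hw => Finset.mem_union_left _ (hU w (valid_succ.1 hw)),
      hφ.congr fun w => valid_succ⟩
  | j + 1, S, Z, U₁, U₂, φ₁, hZ, hj, hdisj, hcl, hst, hφ, hU => by
    have hss : Z ⊂ X := by
      refine hZ.ssubset_of_ne ?_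
      rintro rfl
      simp at hj
    obtain ⟨r, hr, hrZ, hnext⟩ := hchild.exists_next X Z hX hss
    have hcr := hchild.card X r hX hr
    rw [Nat.succ_mul, add_comm] at hst
    obtain ⟨U₃, U₄, h3, h4, h34, hst3, hst4⟩ := hSt.split hst
    have h13 : Disjoint U₁ U₃ := hdisj.mono_right h3
    have h14 : Disjoint U₁ U₄ := hdisj.mono_right h4
    refine hM.bind (ih hcr hst3) ?_
    rintro T ⟨hag, φ₂, hU₂, hφ₂⟩
    have hφT := hag.realizes hφ fun w hw => Finset.disjoint_left.1 h13 (hU w hw)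
    have hclT : T.IsClosed U₁ := hag.isClosed h13.symm hcl
    have hcl3 : T.IsClosed U₃ := hag.isClosed_self (hSt.closed hst3)
    have hx : φ₁ [] ∈ U₁ := hU [] branch_nil
    have hy : φ₂ [] ∈ U₃ := hU₂ [] valid_nil
    have hcx : T.colorsAt (φ₁ []) = Z := hφT.colorsAt_root fun _ _ => valid_nil
    have hcy : T.colorsAt (φ₂ []) = child X r :=
      (hφ₂.congr fun w => (valid_succ (k := k)).symm).colorsAt_root fun _ _ => valid_nil
    have hcardZ := Finset.card_lt_card hss
    have hcan : T.CanAdd (φ₁ []) (φ₂ []) r :=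
      ⟨hclT.not_reachable hx (Finset.disjoint_right.1 h13 hy), by rw [hcx]; omega,
        by rw [hcy]; omega, by rwa [hcx], by rw [hcy]; exact hchild.notMem X r hX hr⟩
    refine hM.bind (hM.insert (P := fun T' => ∃ d, ∃ h : T.CanAdd (φ₁ []) (φ₂ []) d,
      T' = T.addEdge _ _ d h) hcan fun d h => ⟨d, h, rfl⟩) ?_
    rintro _ ⟨d, h, rfl⟩
    have hdZ : d ∉ Z := hcx ▸ h.left
    have hdr : d ∉ child X r := hcy ▸ h.right
    have hdX : d ∈ X := by
      by_contra hd
      exact hdr (hchild.compl X r hX hr (Finset.mem_compl.2 hd))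
    have heq := hnext d hdX hdZ hdr
    -- Since `child X d = child X r`, the tree prepared for `r` serves equally well as the subtree
    -- along `d`.
    rw [← heq] at hφ₂ hU₂
    have hφ' := hφT.realizes_graft (Q := fun r => Valid child (k + 1) (child X r)) (d := d) hφ₂
      (fun w w' hw hw' he => Finset.disjoint_left.1 h13 (hU w hw) (he ▸ hU₂ w' hw'))
      valid_nil hdZ h
    have hagE : AgreeOff (U₁ ∪ U₃) T (T.addEdge _ _ d h) :=
      agreeOff_addEdge h (Finset.mem_union_left _ hx) (Finset.mem_union_right _ hy)
    have hagS : AgreeOff (U₁ ∪ U₃) S (T.addEdge _ _ d h) :=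
      (hag.mono Finset.subset_union_right).trans hagE
    have hd' : Disjoint (U₁ ∪ U₃) U₄ := Finset.disjoint_union_left.2 ⟨h14, h34⟩
    have hsub : (U₁ ∪ U₃) ∪ U₄ ⊆ U₁ ∪ U₂ :=
      Finset.union_subset (Finset.union_subset_union le_rfl h3)
        (h4.trans Finset.subset_union_right)
    refine hM.mono (build_loop hX ih j (Z := insert d Z) (Finset.insert_subset hdX hZ) ?_ hd'
      (hagE.isClosed_self (hclT.union hcl3)) (hSt.agree hst4 hagS hd') hφ' ?_) ?_
    · rw [Finset.sdiff_insert, Finset.card_erase_of_mem (by simp [hdX, hdZ]), hj]; rfl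
    · intro w hw
      rcases branch_insert.1 hw with hw | ⟨w', rfl, hw'⟩
      · rw [graft_eq hdZ hw]
        exact Finset.mem_union_left _ (hU w hw)
      · simp only [ColoredForest.graft, if_true]
        exact Finset.mem_union_right _ (hU₂ w' hw')
    · rintro T' ⟨hag', φ, hφU, hφ⟩
      exact ⟨(hagS.mono (Finset.subset_union_left.trans hsub)).trans (hag'.mono hsub), φ,
        fun w hw => hsub (hφU w hw), hφ⟩

/-- The induction starts at depth one, with a star from the stock: a bare leaf would put no
constraint on the colour of the edge that attaches it. -/
theorem build : ∀ {k : ℕ} {X : Finset (Fin κ)} {S : ColoredForest n Δ κ} {U : Finset (Fin n)},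
    X.card + 1 = Δ → St S (Δ ^ k) U →
      M (fun T => AgreeOff U S T ∧ ∃ φ, (∀ w, Valid child (k + 1) X w → φ w ∈ U) ∧
        T.Realizes (Valid child (k + 1) X) φ) S
  | 0, X, S, U, hX, hst => by
    refine hM.mono (hSt.star (Z := X) (by simpa using hst) (by omega)) ?_
    rintro T ⟨hag, φ, hU, hφ⟩
    have : ∀ w, Valid child 1 X w ↔ Branch X (fun _ w => w = []) w := by
      intro w
      rw [valid_succ]
      cases w <;> simp [Branch, valid_zero]
    exact ⟨hag, φ, fun w hw => hU w ((this w).1 hw), hφ.congr this⟩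
  | k + 1, X, S, U, hX, hst => by
    have hpos : 0 < Δ ^ k := Nat.pow_pos (by omega)
    -- One star provides the bare root, and each of the `Δ - 1` subtrees uses `Δ ^ k` stars.
    have hle : 1 + X.card * Δ ^ k ≤ Δ ^ (k + 1) := by
      have : Δ ^ (k + 1) = (X.card + 1) * Δ ^ k := by rw [hX, pow_succ, mul_comm]
      rw [this, add_mul]
      omega
    obtain ⟨U₁, U₂, h1, h2, h12, hst1, hst2⟩ := hSt.split (hSt.mono hst hle)
    refine hM.bind (hSt.star (Z := ∅) hst1 (Nat.zero_le _)) ?_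
    rintro T ⟨hag, φ₁, hU, hφ⟩
    have hbr : ∀ w, Branch ∅ (fun r => Valid child (k + 1) (child X r)) w ↔
        Branch ∅ (fun _ w => w = []) w := by
      intro w; cases w <;> simp [Branch]
    refine hM.mono (build_loop hM hSt hchild hX (fun hX' hst' => build hX' hst') X.card
      (Z := ∅) (by simp) (by simp) h12 (hag.isClosed_self (hSt.closed hst1))
      (hSt.agree hst2 hag h12) (hφ.congr hbr) fun w hw => hU w ((hbr w).1 hw)) ?_
    rintro T' ⟨hag', φ, hφU, hφ⟩
    have hsub : U₁ ∪ U₂ ⊆ U := Finset.union_subset h1 h2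
    exact ⟨(hag.mono h1).trans (hag'.mono hsub), φ, fun w hw => hsub (hφU w hw), hφ⟩

end Build

end ColoredForest

/-! ### Colour sets that can be made from copies of one set. -/

namespace ColoredForest

section Avail

variable {κ : ℕ}

/-- The sets of colours that can be obtained at a vertex from vertices with the set of colours `W`,
by the deletion of edges, and by the insertion of edges from a vertex with the colours `Z` to
vertices with the colours `Y` until no common free colour is left. -/
inductive Avail (Δ : ℕ) (W : Finset (Fin κ)) : Finset (Fin κ) → Prop
  | self : Avail Δ W W
  | mono {Z Z'} : Avail Δ W Z → Z' ⊆ Z → Avail Δ W Z'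
  | join {Z Y} : Avail Δ W Z → Avail Δ W Y → Y.card < Δ → (Z ∪ Yᶜ).card ≤ Δ →
      Avail Δ W (Z ∪ Yᶜ)

variable {Δ c : ℕ} {W : Finset (Fin κ)}

/-- A join takes in all of `Yᶜ`, so `Z` is assembled from sets `Yᶜ` that lie inside `Z` and cover
its missing part. -/
theorem avail_of_cover {Z : Finset (Fin κ)} (hZ : Z.card ≤ Δ) :
    ∀ (j : ℕ) {Z₀ : Finset (Fin κ)}, (Z \ Z₀).card = j → Z₀ ⊆ Z → Avail Δ W Z₀ →
      (∀ z ∈ Z, z ∉ Z₀ → ∃ Y, Avail Δ W Y ∧ Y.card < Δ ∧ Yᶜ ⊆ Z ∧ z ∉ Y) → Avail Δ W Z := by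
  intro j
  induction j using Nat.strong_induction_on with
  | _ j ih =>
    intro Z₀ hj hsub hav hcov
    by_cases hZZ : Z ⊆ Z₀
    · exact hav.mono hZZ
    · obtain ⟨z, hz, hz0⟩ := Finset.not_subset.1 hZZ
      obtain ⟨Y, hY, hYc, hYZ, hzY⟩ := hcov z hz hz0
      have hsub' : Z₀ ∪ Yᶜ ⊆ Z := Finset.union_subset hsub hYZ
      refine ih (Z \ (Z₀ ∪ Yᶜ)).card ?_ rfl hsub'
        (hav.join hY hYc ((Finset.card_le_card hsub').trans hZ))
        (fun z' hz' hn => hcov z' hz' fun h => hn (Finset.mem_union_left _ h))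
      rw [← hj]
      refine Finset.card_lt_card ((Finset.ssubset_iff_of_subset
        (Finset.sdiff_subset_sdiff le_rfl Finset.subset_union_left)).2
        ⟨z, Finset.mem_sdiff.2 ⟨hz, hz0⟩, ?_⟩)
      simp [hzY]

/-- Colours outside `W` are the scarce ones, and complementation turns the trace `Wᶜ \ Q₁` of `Y`
outside `W` into the trace `Q₁` of `Yᶜ`. After enlarging `Z` within `W` to `P ∪ Q` of size `Δ`, one
starts from `insert w Q` and covers `P` by sets `Yᶜ = P₁ ∪ Q₁`. -/
theorem avail_step (hκ : κ = Δ + c) (hc : c + 2 ≤ Δ) (hW : W.card = Δ) {Q Q₁ : Finset (Fin κ)}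
    (hQ : Q ⊆ Wᶜ) (hQ₁ : Q₁ ⊆ Q) (hle : Q.card ≤ Q₁.card + 1)
    (hY : ∀ Y : Finset (Fin κ), Y.card < Δ → Y \ W = Wᶜ \ Q₁ → Avail Δ W Y)
    {Z : Finset (Fin κ)} (hZ : Z.card ≤ Δ) (hZQ : Z \ W = Q) : Avail Δ W Z := by
  have hWc : Wᶜ.card = c := by rw [Finset.card_compl, hW, Fintype.card_fin]; omega
  have hQc := Finset.card_le_card hQ
  have hQ₁c := Finset.card_le_card hQ₁
  have hcardZ : (Z ∩ W).card + Q.card = Z.card := by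
    rw [← hZQ]; exact Finset.card_inter_add_card_sdiff Z W
  obtain ⟨P, hP₁, hP₂, hP⟩ := Finset.exists_subsuperset_card_eq (n := Δ - Q.card)
    (Finset.inter_subset_right : Z ∩ W ⊆ W) (by omega) (by omega)
  have hdisj : ∀ {A B : Finset (Fin κ)}, A ⊆ W → B ⊆ Wᶜ → Disjoint A B := fun hA hB =>
    (disjoint_compl_right (a := W)).mono hA hB
  have hPQ : (P ∪ Q).card ≤ Δ := by
    rw [Finset.card_union_of_disjoint (hdisj hP₂ hQ)]; omega
  have hZsub : Z ⊆ P ∪ Q := by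
    intro a ha
    by_cases haW : a ∈ W
    · exact Finset.mem_union_left _ (hP₁ (Finset.mem_inter.2 ⟨ha, haW⟩))
    · exact Finset.mem_union_right _ (hZQ ▸ Finset.mem_sdiff.2 ⟨ha, haW⟩)
  refine Avail.mono ?_ hZsub
  obtain ⟨w, hw⟩ := Finset.card_pos.1 (show 0 < P.card by omega)
  have hwW := hP₂ hw
  have hcompl : (W.erase w)ᶜ = insert w Wᶜ := by
    ext a; by_cases h : a = w <;> simp [h]
  -- A join needs a vertex of degree below `Δ`; a copy of `W` without `w` brings in `w` and all of
  -- `Wᶜ`, and the surplus is deleted.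
  have hbase : Avail Δ W (insert w Q) := by
    refine Avail.mono (Z := {w} ∪ (W.erase w)ᶜ) (Avail.join (Avail.self.mono (by simpa))
      (Avail.self.mono (Finset.erase_subset _ _)) ?_ ?_) ?_
    · rw [Finset.card_erase_of_mem hwW]; omega
    · rw [hcompl, Finset.union_eq_right.2 (by simp)]
      have := Finset.card_insert_le w Wᶜ
      omega
    · rw [hcompl, Finset.union_eq_right.2 (by simp)]
      exact Finset.insert_subset_insert _ hQ
  refine avail_of_cover hPQ _ rfl (Finset.insert_subset (Finset.mem_union_left _ hw)
    Finset.subset_union_right) hbase fun z hz hz0 => ?_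
  have hzP : z ∈ P := by
    rcases Finset.mem_union.1 hz with h | h
    · exact h
    · exact absurd (Finset.mem_insert_of_mem h) hz0
  -- This size gives `Y = (P₁ ∪ Q₁)ᶜ` exactly `Δ - 1` colours. It fits into `P`, of size `Δ -
  -- Q.card`, because `Q` exceeds `Q₁` by at most one element and `c + 2 ≤ Δ`.
  obtain ⟨P₁, hzP₁, hP₁P, hP₁c⟩ := Finset.exists_subsuperset_card_eq (n := c + 1 - Q₁.card)
    (Finset.singleton_subset_iff.2 hzP) (by simp; omega) (by omega)
  have hYcard : (P₁ ∪ Q₁)ᶜ.card < Δ := by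
    rw [Finset.card_compl, Finset.card_union_of_disjoint
      (hdisj (hP₁P.trans hP₂) (hQ₁.trans hQ)), Fintype.card_fin]
    omega
  refine ⟨(P₁ ∪ Q₁)ᶜ, hY _ hYcard ?_, hYcard, ?_, ?_⟩
  · ext a
    have := @hP₁P a
    have := @hP₂ a
    simp only [Finset.mem_sdiff, Finset.mem_compl, Finset.mem_union]
    tauto
  · rw [compl_compl]
    exact Finset.union_subset_union hP₁P hQ₁
  · rw [Finset.notMem_compl]
    exact Finset.mem_union_left _ (hzP₁ (Finset.mem_singleton_self z))

theorem avail_of_card_le (hκ : κ = Δ + c) (hc : c + 2 ≤ Δ) (hW : W.card = Δ) :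
    ∀ (q : ℕ) {Z : Finset (Fin κ)}, Z.card ≤ Δ → (Z \ W).card = q → Avail Δ W Z
  | 0, Z, _, hq => by
    rw [Finset.card_eq_zero, Finset.sdiff_eq_empty_iff_subset] at hq
    exact Avail.self.mono hq
  | q + 1, Z, hZ, hq => by
    have hWc : Wᶜ.card = c := by rw [Finset.card_compl, hW, Fintype.card_fin]; omega
    have hsub : ∀ Y : Finset (Fin κ), Y \ W ⊆ Wᶜ := fun Y a ha =>
      Finset.mem_compl.2 (Finset.mem_sdiff.1 ha).2
    obtain ⟨a, ha⟩ := Finset.card_pos.1 (show 0 < (Z \ W).card by omega)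
    have hcard : ((Z \ W).erase a).card = q := by rw [Finset.card_erase_of_mem ha, hq]; rfl
    -- The first step drops `a` and complements the trace within `Wᶜ`; the second complements it
    -- back. What remains is a trace with `q` elements.
    refine avail_step hκ hc hW (hsub Z) (Finset.erase_subset a _) (by omega) ?_ hZ rfl
    intro Y hY hYW
    refine avail_step hκ hc hW (hsub Y) (le_refl (Y \ W)) (by omega) ?_ hY.le rfl
    intro Y' hY' hYW'
    refine avail_of_card_le hκ hc hW q hY'.le ?_
    rw [hYW', hYW, sdiff_sdiff_eq_self ((Finset.erase_subset a _).trans (hsub Z)), hcard]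

end Avail

/-! ### The adaptive adversary. -/

variable {n Δ κ : ℕ} {S T : ColoredForest n Δ κ}

/-- By an adaptive choice of updates, every greedy algorithm in the state `S` can be led to a state
with the property `P`. -/
inductive Forces (P : ColoredForest n Δ κ → Prop) : ColoredForest n Δ κ → Prop
  | pure {S : ColoredForest n Δ κ} : P S → Forces P S
  | step {S : ColoredForest n Δ κ} (a : Update n) : a.Admissible Δ S.graph → (∀ T, GreedyStep S a T → Forces P T) →
      Forces P S

theorem Forces.bind {P Q : ColoredForest n Δ κ → Prop} (h : Forces P S)
    (hPQ : ∀ T, P T → Forces Q T) : Forces Q S := by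
  induction h with
  | pure hP => exact hPQ _ hP
  | step a ha _ ih => exact .step a ha ih

theorem isGame_forces : IsGame (Forces (n := n) (Δ := Δ) (κ := κ)) where
  pure := .pure
  bind := .bind
  insert := by
    intro P S u v d hd h
    refine .step (.insert u v) hd.admissible fun T hT => ?_
    obtain ⟨d', h', rfl⟩ := eq_addEdge_of_greedyStep hd hT
    exact .pure (h d' h')

theorem Forces.mono {P Q : ColoredForest n Δ κ → Prop} (h : Forces P S)
    (hPQ : ∀ T, P T → Q T) : Forces Q S := isGame_forces.mono h hPQ

theorem forces_prune (E : Finset (Sym2 (Fin n))) (S : ColoredForest n Δ κ) :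
    Forces (fun T => ∀ e, T.color e = if e ∈ E then none else S.color e) S := by
  classical
  induction E using Finset.induction_on with
  | empty => exact .pure (by simp)
  | insert a E ha ih =>
    refine ih.bind fun T hT => ?_
    have key : ∀ e, (if e ∈ insert a E then none else S.color e) =
        Function.update T.color a none e := by
      intro e
      by_cases he : e = a
      · subst he; simp
      · simp [he, hT e]
    induction a using Sym2.ind with
    | _ u v =>
    by_cases hadj : T.graph.Adj u v
    · refine .step (.delete u v) hadj fun T' hT' => .pure fun e => ?_
      rw [eq_deleteEdge_of_greedyStep hT', deleteEdge_color, key]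
    · refine .pure fun e => ?_
      rw [key, ← T.color_eq_none_iff.2 hadj, Function.update_eq_self]

/-- There are `m` disjoint sets within `U` that no edge leaves and that contain a vertex with the
set of colours `W`. -/
def Stock (W : Finset (Fin κ)) (S : ColoredForest n Δ κ) (m : ℕ) (U : Finset (Fin n)) : Prop :=
  S.IsClosed U ∧ ∃ C : Finset (Finset (Fin n)), m ≤ C.card ∧
    (C : Set (Finset (Fin n))).PairwiseDisjoint id ∧
    ∀ B ∈ C, B ⊆ U ∧ S.IsClosed B ∧ ∃ x ∈ B, S.colorsAt x = W

namespace Stock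

variable {W : Finset (Fin κ)} {U V : Finset (Fin n)} {m m' : ℕ}

theorem mono (h : Stock W S m U) (hm : m' ≤ m) : Stock W S m' U := by
  obtain ⟨hU, C, hC, h'⟩ := h
  exact ⟨hU, C, hm.trans hC, h'⟩

theorem split {a b : ℕ} (h : Stock W S (a + b) U) :
    ∃ U₁ U₂, U₁ ⊆ U ∧ U₂ ⊆ U ∧ Disjoint U₁ U₂ ∧ Stock W S a U₁ ∧ Stock W S b U₂ := by
  classical
  obtain ⟨hU, C, hC, hdisj, h⟩ := h
  obtain ⟨C₁, hC₁, hcard⟩ := Finset.exists_subset_card_eq (s := C) (n := a) (by omega)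
  have hcl : S.IsClosed (C₁.biUnion id) := by
    intro x hx y d hd
    rw [Finset.mem_biUnion] at hx ⊢
    obtain ⟨B, hB, hxB⟩ := hx
    exact ⟨B, hB, (h B (hC₁ hB)).2.1 x hxB y d hd⟩
  refine ⟨C₁.biUnion id, U \ C₁.biUnion id, ?_, Finset.sdiff_subset, Finset.disjoint_sdiff,
    ⟨hcl, C₁, hcard.ge, hdisj.subset hC₁, fun B hB =>
      ⟨Finset.subset_biUnion_of_mem id hB, (h B (hC₁ hB)).2⟩⟩,
    ⟨?_, C \ C₁, ?_, hdisj.subset Finset.sdiff_subset, fun B hB => ⟨?_, (h B ?_).2⟩⟩⟩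
  · exact Finset.biUnion_subset.2 fun B hB => (h B (hC₁ hB)).1
  · intro x hx y d hd
    rw [Finset.mem_sdiff] at hx ⊢
    exact ⟨hU x hx.1 y d hd, fun hy => hx.2 (hcl y hy x d (Sym2.eq_swap ▸ hd))⟩
  · rw [Finset.card_sdiff_of_subset hC₁]; omega
  · rw [Finset.mem_sdiff] at hB
    intro x hx
    refine Finset.mem_sdiff.2 ⟨(h B hB.1).1 hx, fun hx' => ?_⟩
    obtain ⟨B', hB', hxB'⟩ := Finset.mem_biUnion.1 hx'
    have hne : B ≠ B' := fun he => hB.2 (he ▸ hB')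
    exact Finset.disjoint_left.1 (hdisj hB.1 (hC₁ hB') hne) hx hxB'
  · exact (Finset.mem_sdiff.1 hB).1

theorem agree (h : Stock W S m U) (hag : AgreeOff V S T) (hVU : Disjoint V U) :
    Stock W T m U := by
  obtain ⟨hU, C, hC, hdisj, h⟩ := h
  refine ⟨hag.isClosed hVU hU, C, hC, hdisj, fun B hB => ?_⟩
  obtain ⟨hBU, hBc, x, hx, hxW⟩ := h B hB
  refine ⟨hBU, hag.isClosed (hVU.mono_right hBU) hBc, x, hx, ?_⟩
  rw [hag.colorsAt_eq (Finset.disjoint_right.1 hVU (hBU hx)), hxW]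

end Stock

/-- Each round joins `x` to a fresh vertex with colours `Y`. Whatever colour is chosen, it is a new
one from `Yᶜ`, so the union with `Yᶜ` is invariant and the number of missing colours drops by one.
-/
theorem forces_join {W Y : Finset (Fin κ)} {N : ℕ} (hYc : Y.card < Δ)
    (hY : ∀ (S : ColoredForest n Δ κ) (U : Finset (Fin n)), Stock W S N U →
      Forces (fun T => AgreeOff U S T ∧ ∃ x ∈ U, T.colorsAt x = Y) S)
    {Z : Finset (Fin κ)} (hZ : Z.card ≤ Δ) :
    ∀ (j : ℕ) {S : ColoredForest n Δ κ} {U₁ U₂ : Finset (Fin n)} {x : Fin n}, x ∈ U₁ →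
      S.IsClosed U₁ → Disjoint U₁ U₂ → Stock W S (j * N) U₂ → S.colorsAt x ∪ Yᶜ = Z →
      (Z \ S.colorsAt x).card = j →
      Forces (fun T => AgreeOff (U₁ ∪ U₂) S T ∧ ∃ x ∈ U₁ ∪ U₂, T.colorsAt x = Z) S
  | 0, S, U₁, U₂, x, hx, _, _, _, hZx, hj => by
    rw [Finset.card_eq_zero, Finset.sdiff_eq_empty_iff_subset] at hj
    exact .pure ⟨.refl _ _, x, Finset.mem_union_left _ hx,
      Finset.Subset.antisymm (hZx ▸ Finset.subset_union_left) hj⟩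
  | j + 1, S, U₁, U₂, x, hx, hcl, hdisj, hst, hZx, hj => by
    have hsub : S.colorsAt x ⊆ Z := hZx ▸ Finset.subset_union_left
    rw [Nat.succ_mul, add_comm] at hst
    obtain ⟨U₃, U₄, h3, h4, h34, hst3, hst4⟩ := hst.split
    have h13 : Disjoint U₁ U₃ := hdisj.mono_right h3
    have h14 : Disjoint U₁ U₄ := hdisj.mono_right h4
    refine (hY S U₃ hst3).bind ?_
    rintro T ⟨hag, y, hy, hcy⟩
    have hcx : T.colorsAt x = S.colorsAt x := hag.colorsAt_eq (Finset.disjoint_left.1 h13 hx)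
    have hclT : T.IsClosed U₁ := hag.isClosed h13.symm hcl
    have hcl3 : T.IsClosed U₃ := hag.isClosed_self hst3.1
    obtain ⟨r, hr⟩ := Finset.card_pos.1 (show 0 < (Z \ S.colorsAt x).card by omega)
    rw [Finset.mem_sdiff] at hr
    have hlt : (S.colorsAt x).card < Δ :=
      (Finset.card_lt_card ((Finset.ssubset_iff_of_subset hsub).2 ⟨r, hr⟩)).trans_le hZ
    have hmem : ∀ d, d ∉ Y → d ∈ Z := fun d hd => by
      rw [← hZx]; exact Finset.mem_union_right _ (Finset.mem_compl.2 hd)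
    have hcan : T.CanAdd x y r := by
      refine ⟨hclT.not_reachable hx (Finset.disjoint_right.1 h13 hy), by rwa [hcx],
        by rwa [hcy], by rw [hcx]; exact hr.2, fun hrY => ?_⟩
      rw [hcy] at hrY
      have := hr.1
      rw [← hZx, Finset.mem_union, Finset.mem_compl] at this
      exact this.elim hr.2 fun h => h hrY
    refine (isGame_forces.insert (P := fun T' => ∃ d, ∃ h : T.CanAdd x y d,
      T' = T.addEdge _ _ d h) hcan fun d h => ⟨d, h, rfl⟩).bind ?_
    rintro _ ⟨d, h, rfl⟩
    have hagE : AgreeOff (U₁ ∪ U₃) T (T.addEdge _ _ d h) :=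
      agreeOff_addEdge h (Finset.mem_union_left _ hx) (Finset.mem_union_right _ hy)
    have hagS : AgreeOff (U₁ ∪ U₃) S (T.addEdge _ _ d h) :=
      (hag.mono Finset.subset_union_right).trans hagE
    have hd' : Disjoint (U₁ ∪ U₃) U₄ := Finset.disjoint_union_left.2 ⟨h14, h34⟩
    have hsub' : (U₁ ∪ U₃) ∪ U₄ ⊆ U₁ ∪ U₂ :=
      Finset.union_subset (Finset.union_subset_union le_rfl h3)
        (h4.trans Finset.subset_union_right)
    have hdY : d ∉ Y := hcy ▸ h.right
    have hdx : d ∉ S.colorsAt x := hcx ▸ h.left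
    have hce : (T.addEdge _ _ d h).colorsAt x = insert d (S.colorsAt x) := by
      rw [(colorsAt_addEdge h).1, hcx]
    refine (forces_join hYc hY hZ j (Finset.mem_union_left U₃ hx)
      (hagE.isClosed_self (hclT.union hcl3)) hd' (hst4.agree hagS hd') ?_ ?_).mono ?_
    · rw [hce, Finset.insert_union, hZx, Finset.insert_eq_self.2 (hmem d hdY)]
    · rw [hce, Finset.sdiff_insert, Finset.card_erase_of_mem (by simp [hmem d hdY, hdx]), hj]
      rfl
    · rintro T' ⟨hag', x', hx', hZ'⟩
      exact ⟨(hagS.mono (Finset.subset_union_left.trans hsub')).trans (hag'.mono hsub'), x',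
        hsub' hx', hZ'⟩

theorem Avail.forces {W Z : Finset (Fin κ)} (h : Avail Δ W Z) :
    ∃ N, ∀ (n : ℕ) (S : ColoredForest n Δ κ) (U : Finset (Fin n)), Stock W S N U →
      Forces (fun T => AgreeOff U S T ∧ ∃ x ∈ U, T.colorsAt x = Z) S := by
  classical
  induction h with
  | self =>
    refine ⟨1, fun n S U hst => .pure ⟨.refl _ _, ?_⟩⟩
    obtain ⟨-, C, hC, -, h⟩ := hst
    obtain ⟨B, hB⟩ := Finset.card_pos.1 hC
    obtain ⟨hBU, -, x, hx, hxW⟩ := h B hB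
    exact ⟨x, hBU hx, hxW⟩
  | @mono Z Z' _ hsub ih =>
    obtain ⟨N, hN⟩ := ih
    refine ⟨N, fun n S U hst => (hN n S U hst).bind ?_⟩
    rintro T ⟨hag, x, hx, hxZ⟩
    have hcl := hag.isClosed_self hst.1
    refine (forces_prune {e | x ∈ e ∧ ∀ d ∈ Z', T.color e ≠ some d} T).mono fun T' hT' =>
      ⟨hag.trans fun a ha b => ?_, x, hx, ?_⟩
    · rw [hT']
      split_ifs with he
      · symm
        rw [Finset.mem_filter] at he
        rw [Option.eq_none_iff_forall_ne_some]
        intro d hd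
        rcases Sym2.mem_iff.1 he.2.1 with rfl | rfl
        · exact ha hx
        · exact ha (hcl _ hx a d (Sym2.eq_swap ▸ hd))
      · rfl
    · ext d
      rw [mem_colorsAt]
      constructor
      · rintro ⟨w, hw⟩
        rw [hT'] at hw
        split_ifs at hw with he
        by_contra hd
        refine he (Finset.mem_filter.2 ⟨Finset.mem_univ _, Sym2.mem_mk_left _ _, ?_⟩)
        rintro d' hd' hw'
        rw [hw] at hw'
        exact hd (Option.some_injective _ hw' ▸ hd')
      · intro hd
        obtain ⟨w, hw⟩ := mem_colorsAt.1 (hxZ ▸ hsub hd : d ∈ T.colorsAt x)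
        refine ⟨w, ?_⟩
        rw [hT', if_neg, hw]
        rw [Finset.mem_filter]
        exact fun h => h.2.2 d hd hw
  | @join Z Y _ _ hYc hZY ihZ ihY =>
    obtain ⟨N₁, h₁⟩ := ihZ
    obtain ⟨N₂, h₂⟩ := ihY
    -- One vertex with colours `Z`, and at most `Δ` vertices with colours `Y`, one per round.
    refine ⟨N₁ + Δ * N₂, fun n S U hst => ?_⟩
    obtain ⟨U₁, U₂, hU₁, hU₂, hdisj, hst₁, hst₂⟩ := hst.split
    refine (h₁ n S U₁ hst₁).bind ?_
    rintro T ⟨hag, x, hx, hxZ⟩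
    have hle : ((Z ∪ Yᶜ) \ T.colorsAt x).card ≤ Δ :=
      (Finset.card_le_card Finset.sdiff_subset).trans hZY
    refine (forces_join hYc (h₂ n) hZY _ hx (hag.isClosed_self hst₁.1) hdisj
      ((hst₂.agree hag hdisj).mono (Nat.mul_le_mul_right _ hle)) (by rw [hxZ]) rfl).mono ?_
    rintro T' ⟨hag', x', hx', hZ'⟩
    have hsub : U₁ ∪ U₂ ⊆ U := Finset.union_subset hU₁ hU₂
    exact ⟨(hag.mono hU₁).trans (hag'.mono hsub), x', hsub hx', hZ'⟩

/-- There are finitely many pairs `W`, `Z`, so the largest requirement serves them all and does not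
depend on `n`. -/
theorem exists_forces_colorsAt (Δ c : ℕ) (hc : c + 2 ≤ Δ) :
    ∃ N, ∀ (W Z : Finset (Fin (Δ + c))), W.card = Δ → Z.card ≤ Δ →
      ∀ (n : ℕ) (S : ColoredForest n Δ (Δ + c)) (U : Finset (Fin n)), Stock W S N U →
        Forces (fun T => AgreeOff U S T ∧ ∃ x ∈ U, T.colorsAt x = Z) S := by
  classical
  have h : ∀ p : Finset (Fin (Δ + c)) × Finset (Fin (Δ + c)), ∃ N, p.1.card = Δ →
      p.2.card ≤ Δ → ∀ (n : ℕ) (S : ColoredForest n Δ (Δ + c)) (U : Finset (Fin n)),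
        Stock p.1 S N U → Forces (fun T => AgreeOff U S T ∧ ∃ x ∈ U, T.colorsAt x = p.2) S := by
    rintro ⟨W, Z⟩
    by_cases hW : W.card = Δ
    · by_cases hZ : Z.card ≤ Δ
      · obtain ⟨N, hN⟩ := (avail_of_card_le rfl hc hW _ hZ rfl).forces
        exact ⟨N, fun _ _ => hN⟩
      · exact ⟨0, fun _ h => absurd h hZ⟩
    · exact ⟨0, fun h => absurd h hW⟩
  choose N hN using h
  exact ⟨Finset.univ.sup N, fun W Z hW hZ n S U hst => hN (W, Z) hW hZ n S U
    (hst.mono (Finset.le_sup (Finset.mem_univ (W, Z))))⟩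

/-- A vertex whose neighbours have no other neighbours is the centre of a star. -/
theorem realizes_star {x : Fin n} {Z : Finset (Fin κ)} (hx : S.colorsAt x = Z)
    (hstar : ∀ y z d d', S.color s(x, y) = some d → S.color s(y, z) = some d' → z = x) :
    ∃ φ : List (Fin κ) → Fin n, φ [] = x ∧
      S.Realizes (Branch Z (fun _ w => w = [])) φ := by
  classical
  have : Nonempty (Fin n) := ⟨x⟩
  have h : ∀ r ∈ Z, ∃ y, S.color s(x, y) = some r := fun r hr => mem_colorsAt.1 (hx ▸ hr)
  choose! f hf using h
  refine ⟨fun w => match w with | [] => x | r :: _ => f r, rfl, ?_, ?_, ?_⟩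
  · rintro (_ | ⟨r, w⟩) (_ | ⟨r', w'⟩) hw hw' he
    · rfl
    · exact absurd he (ne_of_color (hf r' hw'.1))
    · exact absurd he.symm (ne_of_color (hf r hw.1))
    · obtain ⟨hr, rfl⟩ := hw
      obtain ⟨hr', rfl⟩ := hw'
      have h₁ := hf r hr
      have h₂ := hf r' hr'
      dsimp only at he
      rw [he, h₂] at h₁
      rw [Option.some_injective _ h₁]
  · rintro (_ | ⟨a, w⟩) r hw
    · exact hf r hw.1
    · simpa using hw.2
  · rintro (_ | ⟨a, w⟩) hw z d hd
    · have hdZ : d ∈ Z := hx ▸ mem_colorsAt.2 ⟨z, hd⟩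
      exact .inl ⟨⟨hdZ, rfl⟩, eq_of_color_eq hd (hf d hdZ)⟩
    · obtain ⟨ha, rfl⟩ := hw
      have h₁ := hf a ha
      obtain rfl := hstar _ z a d h₁ hd
      rw [Sym2.eq_swap, h₁] at hd
      obtain rfl := Option.some_injective _ hd
      exact .inr ⟨[], rfl, rfl⟩

theorem isStock_forces {W : Finset (Fin κ)} {N : ℕ}
    (hN : ∀ Z : Finset (Fin κ), Z.card ≤ Δ → ∀ (S : ColoredForest n Δ κ) (U : Finset (Fin n)),
      Stock W S N U → Forces (fun T => AgreeOff U S T ∧ ∃ x ∈ U, T.colorsAt x = Z) S) :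
    IsStock (Forces (n := n) (Δ := Δ) (κ := κ)) (fun S m U => Stock W S (m * N) U) where
  mono := fun h hm => h.mono (Nat.mul_le_mul_right _ hm)
  split := fun h => by rw [add_mul] at h; exact h.split
  agree := fun h => h.agree
  closed := fun h => h.1
  star := by
    classical
    intro S U Z hst hZ
    rw [one_mul] at hst
    refine (hN Z hZ S U hst).bind ?_
    rintro T ⟨hag, x, hx, hxZ⟩
    have hcl := hag.isClosed_self hst.1
    -- Deleting every edge within `U` that misses `x` leaves a star around `x`.
    refine (forces_prune {e | (∀ a ∈ e, a ∈ U) ∧ x ∉ e} T).mono fun T' hT' => ?_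
    have hag' : AgreeOff U T T' := fun a ha b => by
      rw [hT', if_neg]
      rw [Finset.mem_filter]
      exact fun h => ha (h.2.1 a (Sym2.mem_mk_left _ _))
    have hcl' := hag'.isClosed_self hcl
    have hxZ' : T'.colorsAt x = Z := by
      rw [← hxZ]
      ext d
      simp only [mem_colorsAt]
      refine exists_congr fun w => ?_
      rw [hT', if_neg]
      rw [Finset.mem_filter]
      exact fun h => h.2.2 (Sym2.mem_mk_left _ _)
    obtain ⟨φ, hφx, hφ⟩ := realizes_star hxZ' (by
      intro y z d d' hd hd'
      have hy := hcl' x hx y d hd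
      have hz := hcl' y hy z d' hd'
      by_contra hzx
      rw [hT', if_pos] at hd'
      · simp at hd'
      · refine Finset.mem_filter.2 ⟨Finset.mem_univ _, ?_, ?_⟩
        · intro a ha
          rcases Sym2.mem_iff.1 ha with rfl | rfl
          · exact hy
          · exact hz
        · intro hm
          rcases Sym2.mem_iff.1 hm with h | h
          · exact ne_of_color hd h
          · exact hzx h.symm)
    refine ⟨hag.trans hag', φ, fun w hw => ?_, hφ⟩
    rcases w with _ | ⟨r, w⟩
    · rw [hφx]; exact hx
    · obtain ⟨hr, rfl⟩ := hw
      have := hφ.edge [] r ⟨hr, rfl⟩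
      rw [hφx] at this
      exact hcl' x hx _ r this

theorem forces_grow (hκ : Δ ≤ κ) : ∀ (j : ℕ) {S : ColoredForest n Δ κ} {U F : Finset (Fin n)}
    {x : Fin n}, x ∈ U → S.IsClosed U → Disjoint U F → F.card = j →
      (∀ a ∈ F, S.colorsAt a = ∅) → (S.colorsAt x).card + j = Δ →
      Forces (fun T => AgreeOff (U ∪ F) S T ∧ T.IsClosed (U ∪ F) ∧ (T.colorsAt x).card = Δ) S
  | 0, S, U, F, x, _, hcl, _, hF, _, hj => by
    obtain rfl := Finset.card_eq_zero.1 hF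
    exact .pure ⟨.refl _ _, by simpa using hcl, hj⟩
  | j + 1, S, U, F, x, hx, hcl, hdisj, hF, hiso, hj => by
    obtain ⟨y, hy⟩ := Finset.card_pos.1 (show 0 < F.card by omega)
    have hyU : y ∉ U := Finset.disjoint_right.1 hdisj hy
    have hcy := hiso y hy
    obtain ⟨r, hr⟩ : ∃ r, r ∉ S.colorsAt x := by
      by_contra! hall
      have : S.colorsAt x = Finset.univ := Finset.eq_univ_of_forall hall
      rw [this, Finset.card_univ, Fintype.card_fin] at hj
      omega
    have hcan : S.CanAdd x y r := ⟨hcl.not_reachable hx hyU, by omega, by rw [hcy]; simp; omega,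
      hr, by simp [hcy]⟩
    refine (isGame_forces.insert (P := fun T' => ∃ d, ∃ h : S.CanAdd x y d,
      T' = S.addEdge _ _ d h) hcan fun d h => ⟨d, h, rfl⟩).bind ?_
    rintro _ ⟨d, h, rfl⟩
    have hag : AgreeOff (insert y U) S (S.addEdge _ _ d h) :=
      agreeOff_addEdge h (Finset.mem_insert_of_mem hx) (Finset.mem_insert_self _ _)
    have hcly : S.IsClosed (insert y U) := by
      rw [Finset.insert_eq]
      refine IsClosed.union (fun a ha b d hd => ?_) hcl
      rw [Finset.mem_singleton] at ha
      subst ha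
      have := mem_colorsAt.2 ⟨b, hd⟩
      rw [hcy] at this
      simp at this
    have hU : insert y U ∪ F.erase y = U ∪ F := by
      rw [Finset.insert_union, ← Finset.union_insert, Finset.insert_erase hy]
    have hd' : Disjoint (insert y U) (F.erase y) := by
      rw [Finset.disjoint_insert_left]
      exact ⟨by simp, hdisj.mono_right (Finset.erase_subset _ _)⟩
    refine (forces_grow hκ j (F := F.erase y) (Finset.mem_insert_of_mem hx)
      (hag.isClosed_self hcly) hd' ?_ (fun a ha => ?_) ?_).mono ?_
    · rw [Finset.card_erase_of_mem hy, hF]; rfl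
    · rw [hag.colorsAt_eq (Finset.disjoint_right.1 hd' ha)]
      exact hiso a (Finset.mem_of_mem_erase ha)
    · rw [(colorsAt_addEdge h).1, Finset.card_insert_of_notMem h.left]
      omega
    · rw [hU]
      rintro T ⟨hag', hcl', hc'⟩
      exact ⟨(hag.mono (hU ▸ Finset.subset_union_left)).trans hag', hcl', hc'⟩

theorem forces_stars (hκ : Δ ≤ κ) : ∀ (k : ℕ) {S : ColoredForest n Δ κ} {F : Finset (Fin n)},
    (∀ a ∈ F, S.colorsAt a = ∅) → k * (Δ + 1) ≤ F.card →
      Forces (fun T => AgreeOff F S T ∧ ∃ C : Finset (Finset (Fin n)), C.card = k ∧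
        (C : Set (Finset (Fin n))).PairwiseDisjoint id ∧
        ∀ B ∈ C, B ⊆ F ∧ T.IsClosed B ∧ ∃ x ∈ B, (T.colorsAt x).card = Δ) S
  | 0, S, F, _, _ => .pure ⟨.refl _ _, ∅, rfl, by simp, by simp⟩
  | k + 1, S, F, hiso, hF => by
    classical
    rw [Nat.succ_mul] at hF
    obtain ⟨B, hBF, hB⟩ := Finset.exists_subset_card_eq (s := F) (n := Δ + 1) (by omega)
    obtain ⟨x, hx⟩ := Finset.card_pos.1 (show 0 < B.card by omega)
    have hBx : {x} ∪ B.erase x = B := by rw [← Finset.insert_eq, Finset.insert_erase hx]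
    have hg := forces_grow hκ Δ (S := S) (U := {x}) (F := B.erase x) (Finset.mem_singleton_self x)
      (fun a ha b d hd => by
        rw [Finset.mem_singleton] at ha
        subst ha
        have := mem_colorsAt.2 ⟨b, hd⟩
        rw [hiso a (hBF hx)] at this
        simp at this) (by simp) (by rw [Finset.card_erase_of_mem hx, hB]; rfl)
      (fun a ha => hiso a (hBF (Finset.mem_of_mem_erase ha))) (by simp [hiso x (hBF hx)])
    rw [hBx] at hg
    refine hg.bind ?_
    rintro T ⟨hag, hcl, hcx⟩
    refine (forces_stars hκ k (S := T) (F := F \ B) (fun a ha => ?_) ?_).mono ?_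
    · rw [Finset.mem_sdiff] at ha
      rw [hag.colorsAt_eq ha.2, hiso a ha.1]
    · rw [Finset.card_sdiff_of_subset hBF]; omega
    · rintro T' ⟨hag', C, hC, hdisj, h⟩
      have hBC : ∀ B' ∈ C, Disjoint B B' := fun B' hB' =>
        Finset.disjoint_sdiff.mono_right (h B' hB').1
      have hnotMem : B ∉ C := fun hm =>
        Finset.disjoint_left.1 (hBC B hm) hx hx
      have hd : Disjoint (F \ B) B := Finset.sdiff_disjoint
      refine ⟨(hag.mono hBF).trans (hag'.mono Finset.sdiff_subset), insert B C,
        by rw [Finset.card_insert_of_notMem hnotMem, hC], ?_, ?_⟩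
      · rw [Finset.coe_insert]
        exact hdisj.insert fun B' hB' _ => hBC B' hB'
      · intro B' hB'
        rcases Finset.mem_insert.1 hB' with rfl | hB'
        · exact ⟨hBF, hag'.isClosed hd hcl, x, hx, by
            rw [hag'.colorsAt_eq (Finset.disjoint_right.1 hd hx), hcx]⟩
        · exact ⟨(h B' hB').1.trans Finset.sdiff_subset, (h B' hB').2⟩

/-- The colours of the stars are beyond control, but among `2 ^ κ * m` of them at least `m` share
one of the `2 ^ κ` possible colour sets. -/
theorem forces_stock (hκ : Δ ≤ κ) {m : ℕ} {F : Finset (Fin n)}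
    (hiso : ∀ a ∈ F, S.colorsAt a = ∅) (hF : 2 ^ κ * m * (Δ + 1) ≤ F.card) :
    Forces (fun T => AgreeOff F S T ∧ ∃ W : Finset (Fin κ), W.card = Δ ∧ Stock W T m F) S := by
  classical
  refine (forces_stars hκ _ hiso hF).mono ?_
  rintro T ⟨hag, C, hC, hdisj, h⟩
  refine ⟨hag, ?_⟩
  have hcl : S.IsClosed F := fun a ha b d hd => by
    have := mem_colorsAt.2 ⟨b, hd⟩
    rw [hiso a ha] at this
    simp at this
  have h' : ∀ B ∈ C, ∃ W : Finset (Fin κ), W.card = Δ ∧ ∃ x ∈ B, T.colorsAt x = W := by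
    intro B hB
    obtain ⟨x, hx, hc⟩ := (h B hB).2.2
    exact ⟨_, hc, x, hx, rfl⟩
  choose! f hf using h'
  have ht : (Finset.univ : Finset (Finset (Fin κ))).card = 2 ^ κ := by simp
  obtain ⟨W, -, hW⟩ := Finset.exists_le_card_fiber_of_mul_le_card_of_maps_to (s := C)
    (t := Finset.univ) (f := f) (n := m) (fun _ _ => Finset.mem_univ _) Finset.univ_nonempty
    (by rw [ht, hC])
  -- For `m = 0` the fibre may be empty and tells nothing about the size of `W`, so another `W` is
  -- taken.
  rcases Nat.eq_zero_or_pos m with rfl | hm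
  · obtain ⟨W, -, hW⟩ := Finset.exists_subset_card_eq
      (s := (Finset.univ : Finset (Fin κ))) (n := Δ) (by simpa using hκ)
    exact ⟨W, hW, hag.isClosed_self hcl, ∅, by simp, by simp, by simp⟩
  · obtain ⟨B, hB⟩ := Finset.card_pos.1 (hm.trans_le hW)
    rw [Finset.mem_filter] at hB
    refine ⟨W, hB.2 ▸ (hf B hB.1).1, hag.isClosed_self hcl, _, hW,
      hdisj.subset (Finset.filter_subset _ _), fun B' hB' => ?_⟩
    rw [Finset.mem_filter] at hB'
    exact ⟨(h B' hB'.1).1, (h B' hB'.1).2.1, hB'.2 ▸ (hf B' hB'.1).2⟩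

end ColoredForest

/-! ### The game without an opponent, and bare existence of the tree. -/

namespace ColoredForest

variable {n Δ κ : ℕ} {S T : ColoredForest n Δ κ}

/-- Here the builder chooses the colours, so no stock of unwanted stars is needed. This gives the
state `S` already for `n ≥ Δ ^ K`. -/
theorem isGame_exists :
    IsGame (fun (P : ColoredForest n Δ κ → Prop) (_ : ColoredForest n Δ κ) => ∃ T, P T) where
  pure := fun {_ S} h => ⟨S, h⟩
  bind := fun ⟨T, hT⟩ h => h T hT
  insert := fun hd h => ⟨_, h _ hd⟩

theorem exists_star (Z : Finset (Fin κ)) : Z.card ≤ Δ → ∀ {S : ColoredForest n Δ κ} {x : Fin n}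
    {F : Finset (Fin n)}, x ∉ F → (∀ a ∈ insert x F, S.colorsAt a = ∅) → Z.card ≤ F.card →
      ∃ T, AgreeOff (insert x F) S T ∧
        ∃ φ, (∀ w, Branch Z (fun _ w => w = []) w → φ w ∈ insert x F) ∧
          T.Realizes (Branch Z (fun _ w => w = [])) φ := by
  classical
  induction Z using Finset.induction_on with
  | empty =>
    intro _ S x F _ hiso _
    obtain ⟨φ, hφx, hφ⟩ := realizes_star (x := x) (Z := ∅) (hiso x (Finset.mem_insert_self _ _))
      (fun y z d d' hd _ => by
        have := mem_colorsAt.2 ⟨y, hd⟩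
        rw [hiso x (Finset.mem_insert_self _ _)] at this
        simp at this)
    refine ⟨S, .refl _ _, φ, ?_, hφ⟩
    rintro (_ | ⟨r, w⟩) hw
    · rw [hφx]; exact Finset.mem_insert_self _ _
    · simp [Branch] at hw
  | insert d Z hd ih =>
    intro hZ S x F hx hiso hF
    rw [Finset.card_insert_of_notMem hd] at hZ hF
    obtain ⟨y, hy⟩ := Finset.card_pos.1 (show 0 < F.card by omega)
    have hsub : insert x (F.erase y) ⊆ insert x F :=
      Finset.insert_subset_insert _ (Finset.erase_subset _ _)
    obtain ⟨T, hag, φ, hφU, hφ⟩ := ih (by omega) (S := S) (x := x) (F := F.erase y)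
      (fun h => hx (Finset.mem_of_mem_erase h)) (fun a ha => hiso a (hsub ha))
      (by rw [Finset.card_erase_of_mem hy]; omega)
    have hyx : y ≠ x := fun h => hx (h ▸ hy)
    have hynot : y ∉ insert x (F.erase y) := by simp [hyx]
    have hcy : T.colorsAt y = ∅ := by
      rw [hag.colorsAt_eq hynot]; exact hiso y (Finset.mem_insert_of_mem hy)
    have hcx : T.colorsAt (φ []) = Z := hφ.colorsAt_root fun _ _ => rfl
    have hclosed : T.IsClosed {y} := fun a ha b r hr => by
      rw [Finset.mem_singleton] at ha
      subst ha
      have := mem_colorsAt.2 ⟨b, hr⟩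
      rw [hcy] at this
      simp at this
    have hroot := hφU [] branch_nil
    have hne : φ [] ≠ y := fun h => hynot (h ▸ hroot)
    have hadd : T.CanAdd (φ []) ((fun _ : List (Fin κ) => y) []) d :=
      ⟨fun h => hclosed.not_reachable (Finset.mem_singleton_self y) (by simpa using hne) h.symm,
        by rw [hcx]; omega, by rw [hcy]; simp; omega, by rwa [hcx], by simp [hcy]⟩
    have hy' : T.Realizes (fun w => w = []) (fun _ => y) := by
      refine ⟨fun w w' hw hw' _ => by rw [hw, hw'], fun w r hw => by simp at hw,
        fun w _ z r hr => ?_⟩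
      have := mem_colorsAt.2 ⟨z, hr⟩
      rw [hcy] at this
      simp at this
    have hyF : y ∈ insert x F := Finset.mem_insert_of_mem hy
    refine ⟨T.addEdge _ _ d hadd, (hag.mono hsub).trans
      (agreeOff_addEdge hadd (hsub hroot) hyF), _, ?_,
      hφ.realizes_graft (Q := fun _ w => w = []) hy'
        (fun w w' hw _ he => hynot (he ▸ hφU w hw)) rfl hd hadd⟩
    intro w hw
    rcases branch_insert.1 hw with hw | ⟨w', rfl, -⟩
    · rw [graft_eq hd hw]; exact hsub (hφU w hw)
    · simpa [graft] using hyF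

theorem isStock_exists :
    IsStock (fun (P : ColoredForest n Δ κ → Prop) (_ : ColoredForest n Δ κ) => ∃ T, P T)
      (fun S m U => m * (Δ + 1) ≤ U.card ∧ ∀ a ∈ U, S.colorsAt a = ∅) where
  mono := fun h hm => ⟨(Nat.mul_le_mul_right _ hm).trans h.1, h.2⟩
  split := by
    rintro S a b U ⟨hc, hiso⟩
    rw [add_mul] at hc
    obtain ⟨U₁, hU₁, hcard⟩ := Finset.exists_subset_card_eq (s := U) (n := a * (Δ + 1)) (by omega)
    refine ⟨U₁, U \ U₁, hU₁, Finset.sdiff_subset, Finset.disjoint_sdiff,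
      ⟨hcard.ge, fun x hx => hiso x (hU₁ hx)⟩, ?_,
      fun x hx => hiso x (Finset.mem_sdiff.1 hx).1⟩
    rw [Finset.card_sdiff_of_subset hU₁]
    omega
  agree := fun h hag hd => ⟨h.1, fun a ha => by
    rw [hag.colorsAt_eq (Finset.disjoint_right.1 hd ha), h.2 a ha]⟩
  closed := fun h a ha b d hd => by
    have := mem_colorsAt.2 ⟨b, hd⟩
    rw [h.2 a ha] at this
    simp at this
  star := by
    rintro S U Z ⟨hc, hiso⟩ hZ
    obtain ⟨x, hx⟩ := Finset.card_pos.1 (show 0 < U.card by omega)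
    have := exists_star Z hZ (S := S) (x := x) (F := U.erase x) (by simp)
      (by rwa [Finset.insert_erase hx]) (by rw [Finset.card_erase_of_mem hx]; omega)
    rwa [Finset.insert_erase hx] at this

theorem exists_prune (E : Finset (Sym2 (Fin n))) (S : ColoredForest n Δ κ) :
    ∃ T : ColoredForest n Δ κ, ∀ e, T.color e = if e ∈ E then none else S.color e := by
  classical
  induction E using Finset.induction_on with
  | empty => exact ⟨S, by simp⟩
  | insert a E ha ih =>
    obtain ⟨T, hT⟩ := ih
    induction a using Sym2.ind with
    | _ u v =>
    refine ⟨T.deleteEdge u v, fun e => ?_⟩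
    rw [deleteEdge_color]
    by_cases he : e = s(u, v)
    · subst he; simp
    · simp [he, hT e]

/-! ### Uniqueness of the tree up to renaming. -/

/-- `S` consists of the tree with labelling `φ` and isolated vertices. -/
structure IsTree (S : ColoredForest n Δ κ) (P : List (Fin κ) → Prop)
    (φ : List (Fin κ) → Fin n) : Prop extends S.Realizes P φ where
  spanning : ∀ a b d, S.color s(a, b) = some d → ∃ w, P w ∧ φ w = a

open Classical in
/-- The pairs of vertices outside the tree with labelling `φ`. -/
noncomputable def outside (P : List (Fin κ) → Prop) (φ : List (Fin κ) → Fin n) :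
    Finset (Sym2 (Fin n)) :=
  {e | ∀ a ∈ e, ∀ w, P w → φ w ≠ a}

theorem Realizes.isTree {P : List (Fin κ) → Prop} {φ : List (Fin κ) → Fin n}
    (hφ : S.Realizes P φ) (hP : ∀ w r, P (w ++ [r]) → P w)
    (hT : ∀ e, T.color e = if e ∈ outside P φ then none else S.color e) : T.IsTree P φ := by
  have key : ∀ w, P w → ∀ b, T.color s(φ w, b) = S.color s(φ w, b) := by
    intro w hw b
    rw [hT, if_neg]
    simp only [outside, Finset.mem_filter, not_and, not_forall]
    exact fun _ => ⟨φ w, Sym2.mem_mk_left _ _, w, hw, by simp⟩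
  have hclosed : ∀ w, P w → ∀ z d, T.color s(φ w, z) = some d →
      (P (w ++ [d]) ∧ z = φ (w ++ [d])) ∨ ∃ w', w = w' ++ [d] ∧ z = φ w' :=
    fun w hw z d hd => hφ.closed w hw z d (by rwa [key w hw] at hd)
  refine ⟨⟨hφ.inj, fun w r hw => ?_, hclosed⟩, fun a b d hd => ?_⟩
  · rw [key w (hP w r hw), hφ.edge w r hw]
  · by_contra! ha
    have hb : ∃ w, P w ∧ φ w = b := by
      by_contra! hb
      rw [hT, if_pos] at hd
      · simp at hd
      · simp only [outside, Finset.mem_filter]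
        refine ⟨Finset.mem_univ _, fun x hx w hw => ?_⟩
        rcases Sym2.mem_iff.1 hx with rfl | rfl
        · exact ha w hw
        · exact hb w hw
    obtain ⟨w, hw, rfl⟩ := hb
    rcases hclosed w hw a d (Sym2.eq_swap ▸ hd) with ⟨h1, h2⟩ | ⟨w', rfl, h2⟩
    · exact ha _ h1 h2.symm
    · exact ha _ (hP _ _ hw) h2.symm

theorem colorsAt_eq_empty_of_prune {E : Finset (Sym2 (Fin n))} {z : Fin n}
    (hT : ∀ e, T.color e = if e ∈ E then none else S.color e) (hz : S.colorsAt z = ∅) :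
    T.colorsAt z = ∅ := by
  rw [Finset.eq_empty_iff_forall_notMem] at hz ⊢
  intro d hd
  obtain ⟨w, hw⟩ := mem_colorsAt.1 hd
  rw [hT] at hw
  split_ifs at hw
  exact hz d (mem_colorsAt.2 ⟨w, hw⟩)

/-- The words determine all edges and colours, so matching vertices with equal words, extended
arbitrarily to the isolated vertices, is an isomorphism. -/
theorem IsTree.exists_perm {P : List (Fin κ) → Prop} {φ ψ : List (Fin κ) → Fin n}
    (hP : ∀ w r, P (w ++ [r]) → P w) (hS : S.IsTree P φ) (hT : T.IsTree P ψ) :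
    ∃ σ : Equiv.Perm (Fin n), (∀ w, P w → σ (φ w) = ψ w) ∧
      ∀ e : Sym2 (Fin n), T.color (e.map σ) = S.color e := by
  classical
  have hf : Function.Injective (fun w : {w // P w} => φ w) :=
    fun w w' h => Subtype.ext (hS.inj _ _ w.2 w'.2 h)
  have hg : Function.Injective (fun w : {w // P w} => ψ w) :=
    fun w w' h => Subtype.ext (hT.inj _ _ w.2 w'.2 h)
  set e := (Equiv.ofInjective _ hf).symm.trans (Equiv.ofInjective _ hg) with he
  have hσ : ∀ w, P w → e.extendSubtype (φ w) = ψ w := by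
    intro w hw
    have hmem : φ w ∈ Set.range (fun w : {w // P w} => φ w) := ⟨⟨w, hw⟩, rfl⟩
    rw [Equiv.extendSubtype_apply_of_mem e _ hmem, he, Equiv.trans_apply]
    have : (Equiv.ofInjective _ hf).symm ⟨φ w, hmem⟩ = ⟨w, hw⟩ := by
      rw [Equiv.symm_apply_eq]; rfl
    rw [this]
    rfl
  refine ⟨e.extendSubtype, hσ, ?_⟩
  generalize e.extendSubtype = σ at hσ
  have hfwd : ∀ a b d, S.color s(a, b) = some d → T.color s(σ a, σ b) = some d := by
    intro a b d hd
    obtain ⟨w, hw, rfl⟩ := hS.spanning a b d hd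
    rcases hS.closed w hw b d hd with ⟨h1, rfl⟩ | ⟨w', rfl, rfl⟩
    · rw [hσ w hw, hσ _ h1]
      exact hT.edge w d h1
    · rw [hσ _ hw, hσ _ (hP _ _ hw), Sym2.eq_swap]
      exact hT.edge w' d hw
  have hbwd : ∀ a b d, T.color s(σ a, σ b) = some d → S.color s(a, b) = some d := by
    intro a b d hd
    obtain ⟨w, hw, hwa⟩ := hT.spanning _ _ d hd
    rw [← hwa] at hd
    rw [← hσ w hw] at hwa
    obtain rfl := σ.injective hwa
    rcases hT.closed w hw _ d hd with ⟨h1, hb⟩ | ⟨w', rfl, hb⟩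
    · rw [← hσ _ h1] at hb
      obtain rfl := σ.injective hb
      exact hS.edge w d h1
    · rw [← hσ _ (hP _ _ hw)] at hb
      obtain rfl := σ.injective hb
      rw [Sym2.eq_swap]
      exact hS.edge w' d hw
  intro e
  induction e using Sym2.ind with
  | _ a b =>
  rw [Sym2.map_mk]
  refine Option.ext fun d => ⟨fun h => hbwd a b d h, fun h => hfwd a b d h⟩

theorem IsTree.sameUpToRenaming {P : List (Fin κ) → Prop} {φ ψ : List (Fin κ) → Fin n}
    (hP : ∀ w r, P (w ++ [r]) → P w) (hS : S.IsTree P φ) (hT : T.IsTree P ψ)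
    {u v : List (Fin κ)} (hu : P u) (hv : P v) :
    SameUpToRenaming (S.deleteEdge (φ u) (φ v)) (T.deleteEdge (ψ u) (ψ v)) := by
  obtain ⟨σ, hσ, hcol⟩ := hS.exists_perm hP hT
  -- No renaming of colours is needed: both trees use the same set of colour words.
  refine ⟨σ, Equiv.refl _, fun e => ?_⟩
  have : s(ψ u, ψ v) = Sym2.map σ s(φ u, φ v) := by rw [Sym2.map_mk, hσ u hu, hσ v hv]
  rw [deleteEdge_color, deleteEdge_color, this]
  by_cases he : e = s(φ u, φ v)
  · subst he; simp
  · rw [Function.update_of_ne (fun h => he (Sym2.map.injective σ.injective h)),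
      Function.update_of_ne he, hcol]
    simp

/-! ### From adaptive strategies to update sequences, and the main theorem. -/

/-- The graph after a sequence of updates. -/
def finalGraph (G : SimpleGraph (Fin n)) (as : List (Update n)) : SimpleGraph (Fin n) :=
  as.foldl (fun G a => a.apply G) G

theorem admissibleSeq_append {a : Update n} : ∀ {h : List (Update n)} {G : SimpleGraph (Fin n)},
    AdmissibleSeq Δ G (h ++ [a]) ↔ AdmissibleSeq Δ G h ∧ a.Admissible Δ (finalGraph G h)
  | [], G => by simp [AdmissibleSeq, finalGraph]
  | b :: h, G => by
    rw [List.cons_append, AdmissibleSeq, AdmissibleSeq, admissibleSeq_append, and_assoc]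
    rfl

theorem graph_eq_finalGraph {A : List (Update n) → ColoredForest n Δ κ}
    (hA : IsGreedyAlgorithm A) (h : List (Update n)) :
    AdmissibleSeq Δ (⊥ : SimpleGraph (Fin n)) h → (A h).graph = finalGraph ⊥ h := by
  induction h using List.reverseRecOn with
  | nil => intro _; rw [hA.1]; rfl
  | append_singleton h a ih =>
    intro hadm
    rw [(hA.2 h a hadm).2.1, ih (admissibleSeq_append.1 hadm).1, finalGraph, finalGraph,
      List.foldl_append]
    rfl

/-- Against a deterministic algorithm the adaptive strategy follows a single branch, which is a
fixed sequence of updates. -/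
theorem Forces.exists_history {A : List (Update n) → ColoredForest n Δ κ}
    (hA : IsGreedyAlgorithm A) {P : ColoredForest n Δ κ → Prop} (hP : Forces P S) :
    ∀ h, AdmissibleSeq Δ (⊥ : SimpleGraph (Fin n)) h → A h = S →
      ∃ h', AdmissibleSeq Δ (⊥ : SimpleGraph (Fin n)) h' ∧ P (A h') := by
  induction hP with
  | pure hP => rintro h hadm rfl; exact ⟨h, hadm, hP⟩
  | step a ha _ ih =>
    rintro h hadm rfl
    rw [graph_eq_finalGraph hA h hadm] at ha
    have hadm' := admissibleSeq_append.2 ⟨hadm, ha⟩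
    exact ih _ (hA.2 h a hadm') _ hadm' rfl

theorem colorsAt_empty (a : Fin n) : (ColoredForest.empty n Δ κ).colorsAt a = ∅ := by
  rw [Finset.eq_empty_iff_forall_notMem]
  intro d hd
  obtain ⟨w, hw⟩ := mem_colorsAt.1 hd
  simp [ColoredForest.empty] at hw

section Main

variable {child : Finset (Fin κ) → Fin κ → Finset (Fin κ)} {X₀ : Finset (Fin κ)}

theorem valid_of_append {k : ℕ} {X : Finset (Fin κ)} (w : List (Fin κ)) (r : Fin κ)
    (h : Valid child k X (w ++ [r])) : Valid child k X w := (valid_append.1 h).1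

theorem exists_isTree (hchild : IsTypeSystem Δ child) (hX₀ : X₀.card + 1 = Δ) {k : ℕ}
    {F : Finset (Fin n)} (hF : Δ ^ k * (Δ + 1) ≤ F.card) :
    ∃ (T : ColoredForest n Δ κ) (φ : List (Fin κ) → Fin n), T.IsTree (Valid child (k + 1) X₀) φ ∧
      ∀ z ∉ F, T.colorsAt z = ∅ := by
  obtain ⟨T, hag, φ, -, hφ⟩ := build isGame_exists isStock_exists hchild
    (S := ColoredForest.empty n Δ κ) (U := F) hX₀ ⟨hF, fun a _ => colorsAt_empty a⟩
  obtain ⟨T', hT'⟩ := exists_prune (outside (Valid child (k + 1) X₀) φ) T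
  refine ⟨T', φ, hφ.isTree valid_of_append hT', fun z hz => ?_⟩
  exact colorsAt_eq_empty_of_prune hT' ((hag.colorsAt_eq hz).trans (colorsAt_empty z))

theorem forces_isTree (hκ : Δ ≤ κ) (hchild : IsTypeSystem Δ child) (hX₀ : X₀.card + 1 = Δ)
    {N : ℕ} (hN : ∀ (W Z : Finset (Fin κ)), W.card = Δ → Z.card ≤ Δ →
      ∀ (S : ColoredForest n Δ κ) (U : Finset (Fin n)), Stock W S N U →
        Forces (fun T => AgreeOff U S T ∧ ∃ x ∈ U, T.colorsAt x = Z) S) {k : ℕ}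
    {F : Finset (Fin n)} (hF : 2 ^ κ * (Δ ^ k * N) * (Δ + 1) ≤ F.card) :
    Forces (fun T => ∃ φ : List (Fin κ) → Fin n, T.IsTree (Valid child (k + 1) X₀) φ ∧
      ∀ z ∉ F, T.colorsAt z = ∅) (ColoredForest.empty n Δ κ) := by
  refine (forces_stock hκ (fun a _ => colorsAt_empty a) hF).bind ?_
  rintro S ⟨hag, W, hW, hst⟩
  refine (build isGame_forces (isStock_forces fun Z hZ => hN W Z hW hZ) hchild hX₀ hst).bind ?_
  rintro T ⟨hag', φ, -, hφ⟩
  refine (forces_prune (outside (Valid child (k + 1) X₀) φ) T).mono fun T' hT' => ?_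
  refine ⟨φ, hφ.isTree valid_of_append hT', fun z hz => ?_⟩
  exact colorsAt_eq_empty_of_prune hT'
    (((hag.trans hag').colorsAt_eq hz).trans (colorsAt_empty z))

end Main

end ColoredForest

open ColoredForest in
theorem mainTheorem3 :
    ∃ (C : ℝ) (K : ℕ), 0 < C ∧
      ∀ Δ c : ℕ, 3 ≤ Δ → c + 2 ≤ Δ →
        ∃ n₁ : ℕ, ∀ n : ℕ, Δ ^ K ≤ n →
          ∃ S : ColoredForest n Δ (Δ + c),
            IsBadState S (C * Real.logb Δ n) ∧
            (n₁ ≤ n →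
              ∀ A : List (Update n) → ColoredForest n Δ (Δ + c), IsGreedyAlgorithm A →
                ∃ h : List (Update n),
                  AdmissibleSeq Δ (⊥ : SimpleGraph (Fin n)) h ∧
                  SameUpToRenaming S (A h) ∧
                  IsBadState (A h) (C * Real.logb Δ n)) := by
  -- With `m = Nat.log Δ n / 16 ≥ 1` and `D = 2 * m`, one has `logb Δ n ≤ 16 * m + 16 ≤ 32 * m`,
  -- hence `6 * (1 / 48) * logb Δ n ≤ 4 * m = 2 * D`.
  refine ⟨1 / 48, 16, by norm_num, fun Δ c hΔ hc => ?_⟩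
  obtain ⟨child, X₀, X₁, α, β, hchild, hA, hX₀, -, h0, h1⟩ := exists_isTypeSystem hc
  obtain ⟨N, hN⟩ := exists_forces_colorsAt Δ c hc
  -- The tree uses at most `√n` vertices, as `Δ ^ (2 * (4 * m + 3)) ≤ n`. The other factor `√n` pays
  -- for the constant `2 ^ (Δ + c) * N + 1` of the forcing strategy.
  refine ⟨(2 ^ (Δ + c) * N + 1) ^ 2, fun n hn => ?_⟩
  have hn0 : n ≠ 0 := by
    rintro rfl
    have : 0 < Δ ^ 16 := Nat.pow_pos (by omega)
    omega
  obtain ⟨m, hm⟩ : ∃ m, m = Nat.log Δ n / 16 := ⟨_, rfl⟩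
  have hlog : 16 ≤ Nat.log Δ n := Nat.le_log_of_pow_le (by omega) hn
  have hm1 : 1 ≤ m := by omega
  have hpow : Δ ^ (8 * m + 6) ≤ n :=
    (Nat.pow_le_pow_right (by omega) (by omega)).trans (Nat.pow_log_le_self Δ hn0)
  have hB : 6 * (1 / 48 * Real.logb Δ n) ≤ 2 * ((2 * m : ℕ) : ℝ) := by
    have hlt : n < Δ ^ (Nat.log Δ n + 1) := Nat.lt_pow_succ_log_self (by omega) n
    have h2 : Real.logb Δ n ≤ (32 * m : ℕ) := by
      rw [Real.logb_le_iff_le_rpow (by exact_mod_cast (by omega : 1 < Δ))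
        (by exact_mod_cast Nat.pos_of_ne_zero hn0), Real.rpow_natCast]
      exact_mod_cast hlt.le.trans (Nat.pow_le_pow_right (by omega) (by omega))
    push_cast at h2 ⊢
    linarith
  have hsize : Δ ^ (4 * m + 1) * (Δ + 1) + 2 ≤ Δ ^ (4 * m + 3) := by
    have h2 : Δ ^ (4 * m + 3) = Δ ^ (4 * m + 1) * (Δ * Δ) := by ring
    have h3 : 2 ≤ Δ ^ (4 * m + 1) :=
      (by omega : 2 ≤ Δ).trans (Nat.le_self_pow (by omega) Δ)
    have h4 : Δ + 2 ≤ Δ * Δ := by nlinarith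
    have h5 := Nat.mul_le_mul_left (Δ ^ (4 * m + 1)) h4
    rw [h2]
    nlinarith
  have hle : Δ ^ (4 * m + 3) ≤ n :=
    (Nat.pow_le_pow_right (by omega) (by omega)).trans hpow
  have hn2 : 2 ≤ n := by omega
  -- Two vertices are kept out of the construction for the padding updates.
  set z : Fin n := ⟨0, by omega⟩ with hz
  set z' : Fin n := ⟨1, by omega⟩ with hz'
  have hzz : z ≠ z' := by simp [hz, hz', Fin.ext_iff]
  have hF : ({z, z'}ᶜ : Finset (Fin n)).card = n - 2 := by
    rw [Finset.card_compl, Finset.card_pair hzz, Fintype.card_fin]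
  have hbad : ∀ (T : ColoredForest n Δ (Δ + c)) (φ : List (Fin (Δ + c)) → Fin n),
      T.IsTree (Valid child (4 * m + 1 + 1) X₀) φ →
      (∀ y ∉ ({z, z'}ᶜ : Finset (Fin n)), T.colorsAt y = ∅) →
      IsBadState (T.deleteEdge (φ (altWord α β (2 * m))) (φ (altWord α β (2 * m + 1))))
        (1 / 48 * Real.logb Δ n) := fun T φ hφ hiso =>
    isBadState_deleteEdge hchild hA hX₀ h0 h1 hφ.toRealizes (by omega) (by omega) (by simp)
      (hiso z (by simp)) (hiso z' (by simp)) hzz hB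
  obtain ⟨T, φ, hφ, hiso⟩ := exists_isTree (n := n) hchild hX₀ (k := 4 * m + 1)
    (F := {z, z'}ᶜ) (by omega)
  refine ⟨_, hbad T φ hφ hiso, fun hn₁ A hAlg => ?_⟩
  have hbig : 2 ^ (Δ + c) * (Δ ^ (4 * m + 1) * N) * (Δ + 1) ≤ ({z, z'}ᶜ : Finset (Fin n)).card := by
    obtain ⟨q, hq⟩ : ∃ q, q = 2 ^ (Δ + c) * N := ⟨_, rfl⟩
    rw [← hq] at hn₁
    have h2 : (q + 1) * Δ ^ (4 * m + 3) ≤ n := by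
      rw [← Nat.pow_le_pow_iff_left (n := 2) (by norm_num), mul_pow, sq n, ← pow_mul]
      exact Nat.mul_le_mul hn₁ (le_of_eq_of_le (by ring) hpow)
    have h3 : 2 ^ (Δ + c) * (Δ ^ (4 * m + 1) * N) * (Δ + 1) = q * (Δ ^ (4 * m + 1) * (Δ + 1)) := by
      rw [hq]; ring
    have h4 := Nat.mul_le_mul_left (q + 1) hsize
    rw [hF, h3]
    have h5 : (q + 1) * (Δ ^ (4 * m + 1) * (Δ + 1) + 2) =
      q * (Δ ^ (4 * m + 1) * (Δ + 1)) + Δ ^ (4 * m + 1) * (Δ + 1) + 2 * q + 2 := by ring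
    omega
  have hforce := (forces_isTree (by omega) hchild hX₀ (fun W Z hW hZ => hN W Z hW hZ n)
    hbig).bind (Q := fun S' => ∃ (T' : ColoredForest n Δ (Δ + c)) (ψ : List (Fin (Δ + c)) → Fin n),
      T'.IsTree (Valid child (4 * m + 1 + 1) X₀) ψ ∧
      (∀ y ∉ ({z, z'}ᶜ : Finset (Fin n)), T'.colorsAt y = ∅) ∧
      S' = T'.deleteEdge (ψ (altWord α β (2 * m))) (ψ (altWord α β (2 * m + 1)))) (by
    rintro T' ⟨ψ, hψ, hiso'⟩
    have hedge := hψ.edge (altWord α β (2 * m)) _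
      (valid_altWord hA h0 h1 (show 2 * m + 1 ≤ 4 * m + 1 + 1 by omega))
    refine .step (.delete _ _) (T'.adj_iff.2 ⟨_, hedge⟩) fun S' hS' => .pure ?_
    exact ⟨T', ψ, hψ, hiso', eq_deleteEdge_of_greedyStep hS'⟩)
  obtain ⟨h, hadm, T', ψ, hψ, hiso', hAh⟩ := hforce.exists_history hAlg [] trivial hAlg.1
  refine ⟨h, hadm, ?_, ?_⟩
  · rw [hAh]
    exact hφ.sameUpToRenaming valid_of_append hψ (valid_altWord hA h0 h1 (by omega))
      (valid_altWord hA h0 h1 (by omega))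
  · rw [hAh]
    exact hbad T' ψ hψ hiso'
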